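/- For a permutation $\sigma=\sigma_1\cdots\sigma_N$ of $[N]=\{1,\dots,N\}$ let $\mathrm{des}\,\sigma$ be the number of descents $\sigma_i>\sigma_{i+1}$ ($1\le i<N$); $\sigma_i$ and $\sigma_{i+1}$ are then a descent top and a descent bottom. Let $\mathrm{lema}\,\sigma$ and $\mathrm{loma}\,\sigma$ be the numbers of even and of odd left-to-right maxima. Let $\mathrm{les}\,\sigma$ be the number of pairs $(i,j)$ with $2\le i<j\le N$ and $\sigma_{i-1}>\sigma_j>\sigma_i$; let $\mathrm{ress}\,\sigma$ be the number of pairs $1\le i<j\le N-1$ with $\sigma_j>\sigma_i>\sigma_{j+1}$; and let $\mathrm{res}\,\sigma$ be the number of pairs $1\le i<j\le N-1$ with $\sigma_{j+1}>\sigma_i>\sigma_j$. For a value $v$, let $\mathrm{les}_\sigma(v)$ be the number of pairs counted by $\mathrm{les}\,\sigma$ with $\sigma_j=v$, and let $\mathrm{ress}_\sigma(v)$, $\mathrm{res}_\sigma(v)$ be the numbers of pairs counted by $\mathrm{ress}\,\sigma$, $\mathrm{res}\,\sigma$ with $\sigma_i=v$. *E-permutations.* An E-permutation is a permutation $\sigma$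 of $[2n]$ all of whose descents have an even top and an odd bottom, and such that for no $j\in[n]$ are $2j-1$ and $2j$ simultaneously a descent bottom and a descent top. Let $S$ be the set of descent tops and bottoms of $\sigma$, and put $s(x)=S_o(x)-S_e(x)+\varepsilon(x)$, where $S_o(x)$ and $S_e(x)$ are the numbers of odd and of even elements of $S$ less than $x$, and $\varepsilon(x)=1$ if $x\notin S$ or $x$ is odd, $\varepsilon(x)=0$ otherwise. The E-permutation $\sigma$ is normalized if for every $j\in[n]$: (a) if $2j-1\in S$ and $s(2j-1)$ is odd, then $\mathrm{les}_\sigma(2j)$ is even; (b) if $2j-1\in S$ and $s(2j-1)$ is even, then $\mathrm{les}_\sigma(2j-1)$ is even; (c) if $2j\in S$ and $s(2j)$ is odd, then $\mathrm{ress}_\sigma(2j-1)$ is even; (d) if $2j\in S$ and $s(2j)$ is even, then $\mathrm{ress}_\sigma(2j)$ is even. *F-permutations.* For a permutation $\sigma$ of $[2n+1]$ put $\sigma_0=\sigma_{2n+2}=0$, and call $\sigma_i$ a peak if $\sigma_{i-1}<\sigma_i>\sigma_{i+1}$, a valley if $\sigma_{i-1}>\sigma_i<\sigma_{i+1}$,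 and a double descent if $\sigma_{i-1}>\sigma_i>\sigma_{i+1}$. An F-permutation is a permutation $\sigma$ of $[2n+1]$ all of whose descents have an odd top and an odd bottom, which ends with an odd entry, has no double descent, and whose last entry is a peak. Let $a(j)=f(j)-g(j)+1$, where $f(j)$ and $g(j)$ are the numbers of valleys and of peaks less than $j$. The F-permutation $\sigma$ is normalized if for every $i\in[n]$ such that $2i-1$ is a valley or a peak: $\mathrm{res}_\sigma(2i-1)$ is even when $a(2i-1)$ is even, and $\mathrm{les}_\sigma(2i)$ is even when $a(2i-1)$ is odd. Let $$\overline X_n(a,\bar a,p,q,t)=\sum_{\sigma}a^{\mathrm{lema}\,\sigma}\bar a^{\mathrm{loma}\,\sigma}p^{\mathrm{ress}\,\sigma}q^{\mathrm{les}\,\sigma}t^{\mathrm{des}\,\sigma},\qquad \overline Y_n(a,p,q,t)=\sum_{\tau}a^{\mathrm{lema}\,\tau}p^{\mathrm{res}\,\tau}q^{\mathrm{les}\,\tau}t^{\mathrm{des}\,\tau},$$ where $\sigma$ runs over the E-permutations of $[2n]$ and $\tau$ over the F-permutations of $[2n+1]$. Let $\widehat X_n(a,\bar a,p,q,t)$ be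 the same sum as $\overline X_n$, restricted to normalized E-permutations, and let $\widehat Y_n(p,q,t)=\sum_\tau p^{\mathrm{res}\,\tau}q^{\mathrm{les}\,\tau}t^{\mathrm{des}\,\tau}$ over the normalized F-permutations $\tau$ of $[2n+1]$. Corollary. For every $n\ge 0$, $$\overline Y_n(a,p,q,t)=\overline X_n(a,1,p,q,t)\qquad\text{and}\qquad \widehat Y_n(p,q,t)=\widehat X_n(1,1,p,q,t).$$ -/

import Mathlib

namespace EvenOddDrop

variable {N : ℕ}

/-- The `i`-th entry of the word `σ₁ σ₂ … σ_N` of a permutation `σ` of `{1, …, N}`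
(with `{1, …, N}` modelled on `Fin N`), with the convention `σ₀ = σ_{N+1} = 0`. -/
def entry (σ : Equiv.Perm (Fin N)) (i : ℕ) : ℕ :=
  if h : 1 ≤ i ∧ i ≤ N then (σ ⟨i - 1, by omega⟩ : ℕ) + 1 else 0

/-! ### Statistics -/

/-- Number of descents `σ_i > σ_{i+1}`, `1 ≤ i ≤ N - 1`. -/
def des (σ : Equiv.Perm (Fin N)) : ℕ :=
  ((Finset.Ico 1 N).filter fun i => entry σ (i + 1) < entry σ i).card

/-- `σ_i` is a left-to-right maximum. -/
def IsLRMaxAt (σ : Equiv.Perm (Fin N)) (i : ℕ) : Prop :=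
  ∀ j ∈ Finset.Ico 1 i, entry σ j < entry σ i

instance (σ : Equiv.Perm (Fin N)) : DecidablePred (IsLRMaxAt σ) :=
  fun i => by unfold IsLRMaxAt; infer_instance

/-- Number of even left-to-right maxima. -/
def lema (σ : Equiv.Perm (Fin N)) : ℕ :=
  ((Finset.Icc 1 N).filter fun i => IsLRMaxAt σ i ∧ Even (entry σ i)).card

/-- Number of odd left-to-right maxima. -/
def loma (σ : Equiv.Perm (Fin N)) : ℕ :=
  ((Finset.Icc 1 N).filter fun i => IsLRMaxAt σ i ∧ Odd (entry σ i)).card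

/-- Pairs `(i, j)` with `2 ≤ i < j ≤ N` and `σ_{i-1} > σ_j > σ_i`. -/
def lesPairs (σ : Equiv.Perm (Fin N)) : Finset (ℕ × ℕ) :=
  (Finset.Icc 1 N ×ˢ Finset.Icc 1 N).filter fun x =>
    2 ≤ x.1 ∧ x.1 < x.2 ∧ entry σ x.2 < entry σ (x.1 - 1) ∧ entry σ x.1 < entry σ x.2

/-- Pairs `(i, j)` with `1 ≤ i < j ≤ N - 1` and `σ_j > σ_i > σ_{j+1}`. -/
def ressPairs (σ : Equiv.Perm (Fin N)) : Finset (ℕ × ℕ) :=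
  (Finset.Icc 1 N ×ˢ Finset.Icc 1 N).filter fun x =>
    x.1 < x.2 ∧ x.2 + 1 ≤ N ∧ entry σ x.1 < entry σ x.2 ∧ entry σ (x.2 + 1) < entry σ x.1

/-- Pairs `(i, j)` with `1 ≤ i < j ≤ N - 1` and `σ_{j+1} > σ_i > σ_j`. -/
def resPairs (σ : Equiv.Perm (Fin N)) : Finset (ℕ × ℕ) :=
  (Finset.Icc 1 N ×ˢ Finset.Icc 1 N).filter fun x =>
    x.1 < x.2 ∧ x.2 + 1 ≤ N ∧ entry σ x.1 < entry σ (x.2 + 1) ∧ entry σ x.2 < entry σ x.1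

/-- The number of occurrences of the pattern `31-2`. -/
def les (σ : Equiv.Perm (Fin N)) : ℕ := (lesPairs σ).card

/-- The number of occurrences of the pattern `2-31`; the statistic `res` of permutations
with only even-odd descents. -/
def ress (σ : Equiv.Perm (Fin N)) : ℕ := (ressPairs σ).card

/-- The number of occurrences of the pattern `2-13`; the statistic `res` of permutations
with only odd-odd descents. -/
def res (σ : Equiv.Perm (Fin N)) : ℕ := (resPairs σ).card

/-- The number of left embracings of the value `v`: pairs of `lesPairs σ` with `σ_j = v`. -/
def lesAt (σ : Equiv.Perm (Fin N)) (v : ℕ) : ℕ :=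
  ((lesPairs σ).filter fun x => entry σ x.2 = v).card

/-- The number of right embracings of the value `v`: pairs of `ressPairs σ` with `σ_i = v`. -/
def ressAt (σ : Equiv.Perm (Fin N)) (v : ℕ) : ℕ :=
  ((ressPairs σ).filter fun x => entry σ x.1 = v).card

/-- The contribution of the value `v` to `res`: pairs of `resPairs σ` with `σ_i = v`. -/
def resAt (σ : Equiv.Perm (Fin N)) (v : ℕ) : ℕ :=
  ((resPairs σ).filter fun x => entry σ x.1 = v).card

/-! ### Even-odd descent permutations and `E`-permutations -/

/-- The value `v` is a descent top. -/
def IsDescentTop (σ : Equiv.Perm (Fin N)) (v : ℕ) : Prop :=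
  ∃ i ∈ Finset.Ico 1 N, entry σ i = v ∧ entry σ (i + 1) < entry σ i

/-- The value `v` is a descent bottom. -/
def IsDescentBottom (σ : Equiv.Perm (Fin N)) (v : ℕ) : Prop :=
  ∃ i ∈ Finset.Ico 1 N, entry σ (i + 1) = v ∧ entry σ (i + 1) < entry σ i

instance (σ : Equiv.Perm (Fin N)) : DecidablePred (IsDescentTop σ) :=
  fun v => by unfold IsDescentTop; infer_instance

instance (σ : Equiv.Perm (Fin N)) : DecidablePred (IsDescentBottom σ) :=
  fun v => by unfold IsDescentBottom; infer_instance

/-- All descents have an even top and an odd bottom. -/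
def IsEvenOddDescent (σ : Equiv.Perm (Fin N)) : Prop :=
  ∀ i ∈ Finset.Ico 1 N, entry σ (i + 1) < entry σ i →
    Even (entry σ i) ∧ Odd (entry σ (i + 1))

instance : DecidablePred (IsEvenOddDescent (N := N)) :=
  fun σ => by unfold IsEvenOddDescent; infer_instance

/-- `E`-permutations: even-odd descent permutations of `{1, …, 2n}` such that for no
`j ∈ {1, …, n}` are `2j - 1` and `2j` simultaneously a descent bottom and a descent top. -/
def IsEPerm (n : ℕ) (σ : Equiv.Perm (Fin (2 * n))) : Prop :=
  IsEvenOddDescent σ ∧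
    ∀ j ∈ Finset.Icc 1 n, ¬ (IsDescentBottom σ (2 * j - 1) ∧ IsDescentTop σ (2 * j))

instance (n : ℕ) : DecidablePred (IsEPerm n) :=
  fun σ => by unfold IsEPerm; infer_instance

/-- The set `S_σ` of descent tops and descent bottoms. -/
def signature (σ : Equiv.Perm (Fin N)) : Finset ℕ :=
  (Finset.Icc 1 N).filter fun v => IsDescentTop σ v ∨ IsDescentBottom σ v

/-- The signature function
`s(x) = S_o(x) - S_e(x) + (1 if x is an odd element of S or x ∉ S)`, where `S_o(x)`, `S_e(x)`
count the odd and the even elements of `S = S_σ` less than `x`. -/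
def sig (σ : Equiv.Perm (Fin N)) (x : ℕ) : ℤ :=
  (((signature σ).filter fun v => Odd v ∧ v < x).card : ℤ)
    - (((signature σ).filter fun v => Even v ∧ v < x).card : ℤ)
    + (if (x ∈ signature σ ∧ Odd x) ∨ x ∉ signature σ then 1 else 0)

/-- Normalized `E`-permutations. -/
def IsNormalizedEPerm (n : ℕ) (σ : Equiv.Perm (Fin (2 * n))) : Prop :=
  IsEPerm n σ ∧ ∀ j ∈ Finset.Icc 1 n,
    (2 * j - 1 ∈ signature σ → Odd (sig σ (2 * j - 1)) → Even (lesAt σ (2 * j))) ∧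
    (2 * j - 1 ∈ signature σ → Even (sig σ (2 * j - 1)) → Even (lesAt σ (2 * j - 1))) ∧
    (2 * j ∈ signature σ → Odd (sig σ (2 * j)) → Even (ressAt σ (2 * j - 1))) ∧
    (2 * j ∈ signature σ → Even (sig σ (2 * j)) → Even (ressAt σ (2 * j)))

instance (n : ℕ) : DecidablePred (IsNormalizedEPerm n) :=
  fun σ => by unfold IsNormalizedEPerm; infer_instance

/-! ### Odd-odd descent permutations and `F`-permutations -/

/-- The value `v` is a peak (with `σ₀ = σ_{N+1} = 0`). -/
def IsPeak (σ : Equiv.Perm (Fin N)) (v : ℕ) : Prop :=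
  ∃ i ∈ Finset.Icc 1 N, entry σ i = v ∧
    entry σ (i - 1) < entry σ i ∧ entry σ (i + 1) < entry σ i

/-- The value `v` is a valley (with `σ₀ = σ_{N+1} = 0`). -/
def IsValley (σ : Equiv.Perm (Fin N)) (v : ℕ) : Prop :=
  ∃ i ∈ Finset.Icc 1 N, entry σ i = v ∧
    entry σ i < entry σ (i - 1) ∧ entry σ i < entry σ (i + 1)

/-- The value `v` is a double descent (with `σ₀ = σ_{N+1} = 0`). -/
def IsDoubleDescent (σ : Equiv.Perm (Fin N)) (v : ℕ) : Prop :=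
  ∃ i ∈ Finset.Icc 1 N, entry σ i = v ∧
    entry σ i < entry σ (i - 1) ∧ entry σ (i + 1) < entry σ i

instance (σ : Equiv.Perm (Fin N)) : DecidablePred (IsPeak σ) :=
  fun v => by unfold IsPeak; infer_instance

instance (σ : Equiv.Perm (Fin N)) : DecidablePred (IsValley σ) :=
  fun v => by unfold IsValley; infer_instance

instance (σ : Equiv.Perm (Fin N)) : DecidablePred (IsDoubleDescent σ) :=
  fun v => by unfold IsDoubleDescent; infer_instance

/-- All descents have an odd top and an odd bottom. -/
def IsOddOddDescent (σ : Equiv.Perm (Fin N)) : Prop :=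
  ∀ i ∈ Finset.Ico 1 N, entry σ (i + 1) < entry σ i →
    Odd (entry σ i) ∧ Odd (entry σ (i + 1))

instance : DecidablePred (IsOddOddDescent (N := N)) :=
  fun σ => by unfold IsOddOddDescent; infer_instance

/-- `F`-permutations: odd-odd descent permutations of `{1, …, 2n+1}` ending with an odd
entry, without double descents, and whose last entry is a peak. -/
def IsFPerm (n : ℕ) (σ : Equiv.Perm (Fin (2 * n + 1))) : Prop :=
  IsOddOddDescent σ ∧ Odd (entry σ (2 * n + 1)) ∧
    (∀ v ∈ Finset.Icc 1 (2 * n + 1), ¬ IsDoubleDescent σ v) ∧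
    IsPeak σ (entry σ (2 * n + 1))

instance (n : ℕ) : DecidablePred (IsFPerm n) :=
  fun σ => by unfold IsFPerm; infer_instance

/-- `a(j) = f(j) - g(j) + 1`, where `f(j)`, `g(j)` are the numbers of valleys and of peaks
of `σ` that are less than `j`. -/
def levelAt (σ : Equiv.Perm (Fin N)) (j : ℕ) : ℤ :=
  (((Finset.Icc 1 N).filter fun v => IsValley σ v ∧ v < j).card : ℤ)
    - (((Finset.Icc 1 N).filter fun v => IsPeak σ v ∧ v < j).card : ℤ) + 1

/-- `{2i-1, 2i}` is a VOP pair: `2i - 1` is a valley or a peak. -/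
def IsVOP (σ : Equiv.Perm (Fin N)) (i : ℕ) : Prop :=
  IsValley σ (2 * i - 1) ∨ IsPeak σ (2 * i - 1)

instance (σ : Equiv.Perm (Fin N)) : DecidablePred (IsVOP σ) :=
  fun v => by unfold IsVOP; infer_instance

/-- The embracing number of the VOP pair `{2i-1, 2i}`. -/
def vopEmbracing (σ : Equiv.Perm (Fin N)) (i : ℕ) : ℕ :=
  if Even (levelAt σ (2 * i - 1)) then resAt σ (2 * i - 1) else lesAt σ (2 * i)

/-- Normalized `F`-permutations: the embracing number of every VOP pair is even. -/
def IsNormalizedFPerm (n : ℕ) (σ : Equiv.Perm (Fin (2 * n + 1))) : Prop :=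
  IsFPerm n σ ∧ ∀ i ∈ Finset.Icc 1 n, IsVOP σ i → Even (vopEmbracing σ i)

instance (n : ℕ) : DecidablePred (IsNormalizedFPerm n) :=
  fun σ => by unfold IsNormalizedFPerm; infer_instance

/-! ### Generating polynomials

The variables take values in an arbitrary commutative semiring; the formal polynomials are
obtained by taking indeterminates of a polynomial ring. -/

variable {R : Type*} [CommSemiring R]

/-- Generating polynomial of `E`-permutations by `lema`, `loma`, `res`, `les`, `des`. -/
def Xbar (n : ℕ) (a a' p q t : R) : R :=
  ∑ σ ∈ (Finset.univ : Finset (Equiv.Perm (Fin (2 * n)))).filter (IsEPerm n),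
    a ^ lema σ * a' ^ loma σ * p ^ ress σ * q ^ les σ * t ^ des σ

/-- Generating polynomial of normalized `E`-permutations. -/
def Xhat (n : ℕ) (a a' p q t : R) : R :=
  ∑ σ ∈ (Finset.univ : Finset (Equiv.Perm (Fin (2 * n)))).filter (IsNormalizedEPerm n),
    a ^ lema σ * a' ^ loma σ * p ^ ress σ * q ^ les σ * t ^ des σ

/-- Generating polynomial of `F`-permutations by `lema`, `res`, `les`, `des`. -/
def Ybar (n : ℕ) (a p q t : R) : R :=
  ∑ σ ∈ (Finset.univ : Finset (Equiv.Perm (Fin (2 * n + 1)))).filter (IsFPerm n),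
    a ^ lema σ * p ^ res σ * q ^ les σ * t ^ des σ

/-- Generating polynomial of normalized `F`-permutations by `res`, `les`, `des`. -/
def Yhat (n : ℕ) (p q t : R) : R :=
  ∑ σ ∈ (Finset.univ : Finset (Equiv.Perm (Fin (2 * n + 1)))).filter (IsNormalizedFPerm n),
    p ^ res σ * q ^ les σ * t ^ des σ

end EvenOddDrop

namespace EvenOddDrop

open Finset

/-! ### Level crossings of words -/

/-! Both families are encoded by Laguerre histories, that is, by inserting the values 1, 2, … in
order. The step of a value `v` records whether `v` is preceded by a larger entry, whether it is
followed by a smaller one, and how many descents to its left straddle it, which is `lesAt`. The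
height before `v` is the number of descents of the extended word that cross level `v`; what remains
of the height on the right of `v` is `ressAt` or `resAt`. A word of length 2n is closed by a large
entry, so its height starts at 0; a word of length 2n+1 is closed by 0, so its height starts at 1.

The history determines the relative order of the positions of any two values
(`IsWord.pos_lt_pos_congr`), so it is injective. The number of histories is the right factorial
(`card_histories_zero`, `card_histories_one`), so it is bijective and no inverse has to be
constructed.

Group the steps of 2j-1 and 2j. The E- and F-conditions then constrain each pair separately
(`isEPerm_iff`, `isFPerm_iff`) and allow an up, a level and a down pair: each generating function is
a sum over weighted Motzkin paths. The F-height is the E-height plus one, and in an F-permutation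
the value 2n+1 closes the path with weight 1. With this shift the ranges and weights of the pairs
agree term by term, which gives the first identity.

Normalization depends on a pair and on the parity of the height (`isNormalizedEPerm_iff`,
`isNormalizedFPerm_iff`). For one parity the weights again agree. For the other, the parity
conditions `Even i` and `Even (h - i)` on the up step and on the matching down step are exchanged
between E and F, so that only the product of the two weights is the same. This suffices by
`motzkin_sum_eq`, since every up step of a path returning to its start is matched with a down step.
-/

/-- The number of descents `w i ≥ c > w (i + 1)` with `i < m`. -/
def downCross (w : ℕ → ℕ) (c m : ℕ) : ℕ :=
  ∑ i ∈ range m, if w (i + 1) < c ∧ c ≤ w i then 1 else 0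

/-- The number of descents `w i > c > w (i + 1)` with `i < m`. -/
def strictCross (w : ℕ → ℕ) (c m : ℕ) : ℕ :=
  ∑ i ∈ range m, if w (i + 1) < c ∧ c < w i then 1 else 0

/-- The number of ascents `w i < c ≤ w (i + 1)` with `i < m`. -/
def upCross (w : ℕ → ℕ) (c m : ℕ) : ℕ :=
  ∑ i ∈ range m, if w i < c ∧ c ≤ w (i + 1) then 1 else 0

/-- Downward and upward crossings of a level alternate, so their counts differ only through the two
endpoints. -/
lemma downCross_add_eq_upCross_add (w : ℕ → ℕ) (c m : ℕ) :
    downCross w c m + (if c ≤ w m then 1 else 0) =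
      upCross w c m + (if c ≤ w 0 then 1 else 0) := by
  induction m with
  | zero => simp [downCross, upCross]
  | succ m ih =>
    simp only [downCross, upCross, sum_range_succ] at ih ⊢
    split_ifs at ih ⊢ <;> omega

lemma downCross_mono (w : ℕ → ℕ) (c : ℕ) : Monotone (downCross w c) := fun _ _ h =>
  sum_le_sum_of_subset (range_mono h)

lemma strictCross_mono (w : ℕ → ℕ) (c : ℕ) : Monotone (strictCross w c) := fun _ _ h =>
  sum_le_sum_of_subset (range_mono h)

lemma downCross_lt {w : ℕ → ℕ} {c a b : ℕ} (hab : a ≤ b) (ha : c ≤ w a) (hb : w b < c) :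
    downCross w c a < downCross w c b := by
  induction b, hab using Nat.le_induction with
  | base => omega
  | succ b hab ih =>
    have h1 : downCross w c (b + 1) =
        downCross w c b + if w (b + 1) < c ∧ c ≤ w b then 1 else 0 := sum_range_succ _ _
    by_cases h : w b < c
    · have := ih h
      omega
    · rw [h1, if_pos ⟨hb, by omega⟩]
      exact Nat.lt_succ_of_le (downCross_mono w c hab)

/-- `w 1, …, w N` is a permutation of `1, …, N` with inverse `pos`, preceded by `0` and followed
by `0` or `N + 1`. -/
structure IsWord (N : ℕ) (w pos : ℕ → ℕ) : Prop where
  zero : w 0 = 0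
  one_le_pos : ∀ v, 1 ≤ v → v ≤ N → 1 ≤ pos v
  pos_le : ∀ v, 1 ≤ v → v ≤ N → pos v ≤ N
  apply_pos : ∀ v, 1 ≤ v → v ≤ N → w (pos v) = v
  one_le : ∀ i, 1 ≤ i → i ≤ N → 1 ≤ w i
  le : ∀ i, 1 ≤ i → i ≤ N → w i ≤ N
  pos_apply : ∀ i, 1 ≤ i → i ≤ N → pos (w i) = i
  last : w (N + 1) = 0 ∨ w (N + 1) = N + 1

namespace IsWord

variable {N : ℕ} {w pos : ℕ → ℕ}

lemma eq_pos_iff (hw : IsWord N w pos) {v i : ℕ} (h1 : 1 ≤ v) (hN : v ≤ N) (hi : i ≤ N + 1) :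
    w i = v ↔ i = pos v := by
  constructor
  · rintro rfl
    have h0 : i ≠ 0 := by
      rintro rfl
      have := hw.zero
      omega
    have h2 : i ≠ N + 1 := by
      rintro rfl
      have := hw.last
      omega
    exact (hw.pos_apply i (by omega) (by omega)).symm
  · rintro rfl
    exact hw.apply_pos v h1 hN

/-- The only non-strict crossing that is not strict is a descent starting at `v` itself. In
`downCross_succ_eq` it is a descent ending at `v`. Together they describe how the crossing counts
change when the level passes `v`. -/
lemma downCross_eq (hw : IsWord N w pos) {v m : ℕ} (h1 : 1 ≤ v) (hN : v ≤ N) (hm : m ≤ N + 1) :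
    downCross w v m =
      strictCross w v m + if pos v < m ∧ w (pos v + 1) < v then 1 else 0 := by
  induction m with
  | zero => simp [downCross, strictCross]
  | succ m ih =>
    have ih := ih (by omega)
    have he := hw.eq_pos_iff h1 hN (i := m) (by omega)
    simp only [downCross, strictCross, sum_range_succ] at ih ⊢
    rw [ih]
    by_cases h : m = pos v
    · subst h
      have := he.2 rfl
      split_ifs <;> omega
    · have : w m ≠ v := fun h' => h (he.1 h')
      split_ifs <;> omega

lemma downCross_succ_eq (hw : IsWord N w pos) {v m : ℕ} (h1 : 1 ≤ v) (hN : v ≤ N)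
    (hm : m ≤ N + 1) :
    downCross w (v + 1) m =
      strictCross w v m + if pos v ≤ m ∧ v < w (pos v - 1) then 1 else 0 := by
  have hp := hw.one_le_pos v h1 hN
  induction m with
  | zero =>
    simp only [downCross, strictCross, range_zero, sum_empty]
    rw [if_neg (by omega), add_zero]
  | succ m ih =>
    have ih := ih (by omega)
    have he := hw.eq_pos_iff h1 hN (i := m + 1) (by omega)
    simp only [downCross, strictCross, sum_range_succ] at ih ⊢
    rw [ih]
    by_cases h : m + 1 = pos v
    · have := he.2 h
      rw [← h]
      simp only [Nat.add_sub_cancel]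
      split_ifs <;> omega
    · have : w (m + 1) ≠ v := fun h' => h (he.1 h')
      split_ifs <;> omega

/-- Up to `pos v` strict and non-strict crossings of level `v` coincide. Going on from `v` to a
smaller `u` on its right costs one more downward crossing, while crossing counts are monotone in the
position. -/
lemma pos_lt_pos_iff (hw : IsWord N w pos) {u v : ℕ} (h1 : 1 ≤ u) (huv : u < v) (hN : v ≤ N) :
    pos v < pos u ↔ strictCross w v (pos v) < downCross w v (pos u) := by
  have hu := hw.pos_le u h1 (by omega)
  have hv := hw.pos_le v (by omega) hN
  constructor
  · intro h
    have h2 := hw.downCross_eq (v := v) (m := pos v) (by omega) hN (by omega)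
    rw [if_neg (by omega), add_zero] at h2
    rw [← h2]
    refine downCross_lt h.le ?_ ?_
    · rw [hw.apply_pos v (by omega) hN]
    · rwa [hw.apply_pos u h1 (by omega)]
  · intro h
    by_contra hc
    have h2 := hw.downCross_eq (v := v) (m := pos u) (by omega) hN (by omega)
    rw [if_neg (by omega), add_zero] at h2
    have := strictCross_mono w v (not_lt.1 hc)
    omega

/-- The value `v` is preceded by a larger entry. -/
def Bot (w pos : ℕ → ℕ) (v : ℕ) : Prop := v < w (pos v - 1)

/-- The value `v` is followed by a smaller entry. -/
def Top (w pos : ℕ → ℕ) (v : ℕ) : Prop := w (pos v + 1) < v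

instance (w pos : ℕ → ℕ) : DecidablePred (Bot w pos) := fun v => by unfold Bot; infer_instance
instance (w pos : ℕ → ℕ) : DecidablePred (Top w pos) := fun v => by unfold Top; infer_instance

variable {w' pos' : ℕ → ℕ}

/-- Induction on the level: the crossings to the left of `u` at one level give the order of `u` and
the next value by `pos_lt_pos_iff`, and this order with the step of that value gives the crossings
at the next level. -/
lemma downCross_pos_congr (hw : IsWord N w pos) (hw' : IsWord N w' pos')
    (hb : ∀ v, 1 ≤ v → v ≤ N → (Bot w pos v ↔ Bot w' pos' v))
    (ht : ∀ v, 1 ≤ v → v ≤ N → (Top w pos v ↔ Top w' pos' v))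
    (hl : ∀ v, 1 ≤ v → v ≤ N → strictCross w v (pos v) = strictCross w' v (pos' v))
    (v : ℕ) (hv : v ≤ N) (u : ℕ) (h1 : 1 ≤ u) (huv : u ≤ v) :
    downCross w (v + 1) (pos u) = downCross w' (v + 1) (pos' u) := by
  induction v generalizing u with
  | zero => omega
  | succ v ih =>
    have hb := hb (v + 1) (by omega) hv
    have ht := ht (v + 1) (by omega) hv
    have hl := hl (v + 1) (by omega) hv
    unfold Bot at hb
    unfold Top at ht
    have p1 := hw.pos_le u h1 (by omega)
    have p2 := hw'.pos_le u h1 (by omega)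
    have e1 := hw.downCross_succ_eq (v := v + 1) (m := pos u) (by omega) hv (by omega)
    have e2 := hw'.downCross_succ_eq (v := v + 1) (m := pos' u) (by omega) hv (by omega)
    rcases huv.eq_or_lt with rfl | hlt
    · rw [e1, e2, hl]
      simp only [le_refl, true_and, hb]
    · have ih := ih (by omega) u h1 (by omega)
      have f1 := hw.downCross_eq (v := v + 1) (m := pos u) (by omega) hv (by omega)
      have f2 := hw'.downCross_eq (v := v + 1) (m := pos' u) (by omega) hv (by omega)
      have o1 := hw.pos_lt_pos_iff h1 hlt hv
      have o2 := hw'.pos_lt_pos_iff h1 hlt hv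
      rw [hl, ih, ← o2] at o1
      have n1 : pos (v + 1) ≤ pos u ↔ pos (v + 1) < pos u := by
        refine ⟨fun h => lt_of_le_of_ne h fun h' => ?_, le_of_lt⟩
        have a1 := hw.apply_pos u h1 (by omega)
        have a2 := hw.apply_pos (v + 1) (by omega) hv
        rw [h'] at a2
        omega
      have n2 : pos' (v + 1) ≤ pos' u ↔ pos' (v + 1) < pos' u := by
        refine ⟨fun h => lt_of_le_of_ne h fun h' => ?_, le_of_lt⟩
        have a1 := hw'.apply_pos u h1 (by omega)
        have a2 := hw'.apply_pos (v + 1) (by omega) hv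
        rw [h'] at a2
        omega
      simp only [n1, o1, hb] at e1
      simp only [n2] at e2
      simp only [o1, ht] at f1
      omega

lemma pos_lt_pos_congr (hw : IsWord N w pos) (hw' : IsWord N w' pos')
    (hb : ∀ v, 1 ≤ v → v ≤ N → (Bot w pos v ↔ Bot w' pos' v))
    (ht : ∀ v, 1 ≤ v → v ≤ N → (Top w pos v ↔ Top w' pos' v))
    (hl : ∀ v, 1 ≤ v → v ≤ N → strictCross w v (pos v) = strictCross w' v (pos' v))
    {u v : ℕ} (h1 : 1 ≤ u) (huv : u < v) (hv : v ≤ N) :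
    pos v < pos u ↔ pos' v < pos' u := by
  obtain ⟨v, rfl⟩ : ∃ k, v = k + 1 := ⟨v - 1, by omega⟩
  rw [hw.pos_lt_pos_iff h1 huv hv, hw'.pos_lt_pos_iff h1 huv hv, hl _ (by omega) hv,
    downCross_pos_congr hw hw' hb ht hl v (by omega) u h1 (by omega)]

lemma downCross_top (hw : IsWord N w pos) : downCross w (N + 1) (N + 1) = 0 := by
  refine sum_eq_zero fun i hi => if_neg ?_
  have hi := mem_range.1 hi
  have h0 := hw.zero
  rcases Nat.eq_zero_or_pos i with rfl | h
  · omega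
  · have := hw.le i h (by omega)
    omega

lemma downCross_one_of_last_ne (hw : IsWord N w pos) (hl : w (N + 1) = N + 1) :
    downCross w 1 (N + 1) = 0 := by
  refine sum_eq_zero fun i hi => if_neg ?_
  have hi := mem_range.1 hi
  by_cases h : i = N
  · subst h
    omega
  · have := hw.one_le (i + 1) (by omega) (by omega)
    omega

lemma downCross_one_of_last_eq (hw : IsWord N w pos) (hN : 1 ≤ N) (hl : w (N + 1) = 0) :
    downCross w 1 (N + 1) = 1 := by
  unfold downCross
  rw [sum_range_succ, if_pos ⟨by omega, hw.one_le N hN le_rfl⟩]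
  suffices h : ∑ i ∈ range N, (if w (i + 1) < 1 ∧ 1 ≤ w i then 1 else 0) = 0 by rw [h]
  refine sum_eq_zero fun i hi => if_neg ?_
  have hi := mem_range.1 hi
  have := hw.one_le (i + 1) (by omega) (by omega)
  omega

/-- The height before and after inserting the value `v`. -/
lemma downCross_succ_add (hw : IsWord N w pos) {v : ℕ} (h1 : 1 ≤ v) (hN : v ≤ N) :
    downCross w (v + 1) (N + 1) + (if Top w pos v then 1 else 0) =
      downCross w v (N + 1) + if Bot w pos v then 1 else 0 := by
  have p := hw.pos_le v h1 hN
  rw [hw.downCross_succ_eq h1 hN le_rfl, hw.downCross_eq h1 hN le_rfl]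
  simp only [show pos v ≤ N + 1 by omega, show pos v < N + 1 by omega, true_and, Bot, Top]
  omega

/-- Bounds the left embracing number by the height and identifies the remainder with `ressAt` when
the word is closed by a large entry. -/
lemma strictCross_add_strict (hw : IsWord N w pos) {v : ℕ} (h1 : 1 ≤ v) (hN : v ≤ N) :
    strictCross w v (pos v) +
        (∑ i ∈ Ico (pos v) (N + 1), if w (i + 1) < v ∧ v < w i then 1 else 0) +
        (if Top w pos v then 1 else 0) = downCross w v (N + 1) := by
  have p := hw.pos_le v h1 hN
  rw [hw.downCross_eq h1 hN le_rfl]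
  simp only [show pos v < N + 1 by omega, true_and, Top, strictCross]
  rw [sum_range_add_sum_Ico _ (by omega)]

/-- Since the word ends at 0, it goes down through level `v` once more often than up on the right of
`v`. This extra crossing is the `+ 1`, and the ascents are those counted by `resAt`. -/
lemma strictCross_add_up (hw : IsWord N w pos) (hl : w (N + 1) = 0) {v : ℕ} (h1 : 1 ≤ v)
    (hN : v ≤ N) :
    strictCross w v (pos v) +
        (∑ i ∈ Ico (pos v) (N + 1), if w i < v ∧ v ≤ w (i + 1) then 1 else 0) + 1 =
      downCross w v (N + 1) := by
  have p := hw.pos_le v h1 hN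
  have h0 := hw.zero
  have e1 := hw.downCross_eq (m := pos v) h1 hN (by omega)
  rw [if_neg (by omega), add_zero] at e1
  have e2 := downCross_add_eq_upCross_add w v (N + 1)
  rw [if_neg (by omega), if_neg (by omega)] at e2
  have e3 := downCross_add_eq_upCross_add w v (pos v)
  rw [if_pos (by rw [hw.apply_pos v h1 hN]), if_neg (by omega)] at e3
  have e4 : upCross w v (pos v) +
      (∑ i ∈ Ico (pos v) (N + 1), if w i < v ∧ v ≤ w (i + 1) then 1 else 0) =
        upCross w v (N + 1) := sum_range_add_sum_Ico _ (by omega)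
  omega

/-- Left-to-right maxima. -/
lemma forall_lt_iff (hw : IsWord N w pos) {v : ℕ} (h1 : 1 ≤ v) (hN : v ≤ N) :
    (∀ j ∈ Ico 1 (pos v), w j < v) ↔ ¬ Bot w pos v ∧ strictCross w v (pos v) = 0 := by
  have p := hw.pos_le v h1 hN
  have p1 := hw.one_le_pos v h1 hN
  have h0 := hw.zero
  constructor
  · intro h
    have h' : ∀ j < pos v, w j < v := fun j hj => by
      rcases Nat.eq_zero_or_pos j with rfl | hj0
      · omega
      · exact h j (mem_Ico.2 ⟨hj0, hj⟩)
    refine ⟨?_, sum_eq_zero fun i hi => if_neg ?_⟩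
    · have := h' (pos v - 1) (by omega)
      unfold Bot
      omega
    · have := h' i (mem_range.1 hi)
      omega
  · rintro ⟨hb, hs⟩ j hj
    obtain ⟨hj1, hj⟩ := mem_Ico.1 hj
    by_contra hc
    have hne : ∀ i < pos v, w i ≠ v := fun i hi h => by
      have := (hw.eq_pos_iff h1 hN (by omega)).1 h
      omega
    have e1 := hw.downCross_eq (m := pos v - 1) h1 hN (by omega)
    rw [if_neg (by omega), add_zero] at e1
    have e2 := strictCross_mono w v (show pos v - 1 ≤ pos v by omega)
    -- If an earlier entry exceeds `v` but the neighbour of `v` does not, some descent in between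
    -- straddles `v`.
    have e3 := downCross_lt (w := w) (c := v) (a := j) (b := pos v - 1) (by omega) (by omega) (by
      have := hne (pos v - 1) (by omega)
      unfold Bot at hb
      omega)
    omega

end IsWord

end EvenOddDrop

namespace EvenOddDrop

open Finset

/-! ### Laguerre histories -/

/-- A step of a Laguerre history: is the inserted value a descent bottom, is it a descent top, and
how many descents to its left does it embrace. -/
abbrev Step := (_ : Bool × Bool) × ℕ

/-- The number of places for the next value at height `h`; `e` is `0` for words followed by a
large entry, `1` for words followed by `0`. -/
def cap (e : ℕ) (bt : Bool × Bool) (h : ℕ) : ℕ := if bt.2 then h else h + 1 - e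

/-- The height after a step. -/
def next (h : ℕ) (bt : Bool × Bool) : ℕ := h + bt.1.toNat - bt.2.toNat

/-- The steps possible at height `h`. -/
def steps (e h : ℕ) : Finset Step := univ.sigma fun bt => range (cap e bt h)

/-- Laguerre histories of length `r` from height `h` to height `0`. -/
def histories (e : ℕ) : ℕ → ℕ → Finset (List Step)
  | 0, h => if h = 0 then {[]} else ∅
  | r + 1, h => ((steps e h).sigma fun s => histories e r (next h s.1)).image
      fun x => x.1 :: x.2

lemma sum_histories_succ {M : Type*} [AddCommMonoid M] (e r h : ℕ) (f : List Step → M) :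
    ∑ l ∈ histories e (r + 1) h, f l =
      ∑ s ∈ steps e h, ∑ l ∈ histories e r (next h s.1), f (s :: l) := by
  rw [histories, sum_image, sum_sigma]
  rintro ⟨s, l⟩ - ⟨s', l'⟩ - h
  simpa using h

lemma sum_steps {M : Type*} [AddCommMonoid M] (e h : ℕ) (f : Step → M) :
    ∑ s ∈ steps e h, f s =
      ((∑ i ∈ range h, f ⟨(true, true), i⟩) + ∑ i ∈ range (h + 1 - e), f ⟨(true, false), i⟩) +
      ((∑ i ∈ range h, f ⟨(false, true), i⟩) + ∑ i ∈ range (h + 1 - e), f ⟨(false, false), i⟩) := by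
  rw [steps, sum_sigma, Fintype.sum_prod_type, Fintype.sum_bool, Fintype.sum_bool,
    Fintype.sum_bool]
  rfl

lemma card_histories_succ (e r h : ℕ) :
    (histories e (r + 1) h).card =
      h * (histories e r h).card + (h + 1 - e) * (histories e r (h + 1)).card +
      (h * (histories e r (h - 1)).card + (h + 1 - e) * (histories e r h).card) := by
  have := sum_histories_succ e r h fun _ => 1
  simp only [sum_const, smul_eq_mul, mul_one] at this
  rw [this, sum_steps]
  simp [next]

/-! ### Counting Laguerre histories -/

/-- Only height 0 is needed, but the recursion involves neighbouring heights. The closed form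
satisfies it by Pascal's rule and the absorption identities for binomial coefficients. -/
lemma card_histories_zero (r h : ℕ) : (histories 0 r h).card = r.factorial * r.choose h := by
  induction r generalizing h with
  | zero => rcases h with _ | h <;> simp [histories]
  | succ r ih =>
    rw [card_histories_succ, ih, ih, ih, Nat.factorial_succ]
    rcases h with _ | h
    · rcases r with _ | r
      · simp
      · simp
        ring
    · have e1 := Nat.choose_succ_right_eq r (h + 1)
      have e2 := Nat.choose_succ_succ' r h
      have e3 := Nat.add_one_mul_choose_eq r h
      simp only [Nat.add_sub_cancel, Nat.sub_zero]
      -- The absorption identity contains a truncated `r - (h + 1)`; in the second case the binomial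
      -- coefficients concerned vanish.
      rcases le_or_gt (h + 1) r with hr | hr
      · obtain ⟨d, rfl⟩ := Nat.exists_eq_add_of_le hr
        rw [Nat.add_sub_cancel_left] at e1
        zify at *
        linear_combination ((h + 1 + d).factorial : ℤ) *
          (e1 - (2 * h + d + 3) * e2 - e3)
      · rw [Nat.choose_eq_zero_of_lt hr, Nat.choose_eq_zero_of_lt (show r < h + 1 + 1 by omega)] at *
        zify at *
        linear_combination (r.factorial : ℤ) * (-(h + r + 2) * e2 - e3)

/-- Height 0 offers no place for a further value: a nonempty remainder of a word closed by 0 has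
positive height. -/
lemma card_histories_one_zero (r : ℕ) : (histories 1 (r + 1) 0).card = 0 := by
  simp [card_histories_succ]

lemma card_histories_one (r h : ℕ) :
    (histories 1 (r + 1) (h + 1)).card = (r + 1).factorial * r.choose h := by
  induction r generalizing h with
  | zero =>
    rw [card_histories_succ]
    rcases h with _ | h <;> simp [histories]
  | succ r ih =>
    rw [card_histories_succ, ih, ih]
    rcases h with _ | h
    · simp [card_histories_one_zero, Nat.factorial_succ]
      ring
    · rw [Nat.add_sub_cancel, Nat.add_sub_cancel, ih, Nat.factorial_succ (r + 1)]
      have e1 := Nat.choose_succ_right_eq r (h + 1)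
      have e2 := Nat.choose_succ_succ' r h
      have e3 := Nat.add_one_mul_choose_eq r h
      rcases le_or_gt (h + 1) r with hr | hr
      · obtain ⟨d, rfl⟩ := Nat.exists_eq_add_of_le hr
        rw [Nat.add_sub_cancel_left] at e1
        zify at *
        linear_combination ((h + 1 + d + 1).factorial : ℤ) *
          (e1 - (2 * h + d + 4) * e2 - e3)
      · rw [Nat.choose_eq_zero_of_lt hr, Nat.choose_eq_zero_of_lt (show r < h + 1 + 1 by omega)] at *
        zify at *
        linear_combination ((r + 1).factorial : ℤ) * (-(h + r + 3) * e2 - e3)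

/-! ### The history of a word -/

namespace IsWord

variable {N : ℕ} {w pos : ℕ → ℕ}

/-- The step inserting the value `v` of a word. -/
def step (w pos : ℕ → ℕ) (v : ℕ) : Step :=
  ⟨(decide (Bot w pos v), decide (Top w pos v)), strictCross w v (pos v)⟩

lemma next_step (hw : IsWord N w pos) {v : ℕ} (h1 : 1 ≤ v) (hN : v ≤ N) :
    next (downCross w v (N + 1)) (step w pos v).1 = downCross w (v + 1) (N + 1) := by
  have := hw.downCross_succ_add h1 hN
  by_cases hb : Bot w pos v <;> by_cases ht : Top w pos v <;>
    simp [next, step, hb, ht] at this ⊢ <;> omega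

lemma step_mem_zero (hw : IsWord N w pos) {v : ℕ} (h1 : 1 ≤ v) (hN : v ≤ N) :
    step w pos v ∈ steps 0 (downCross w v (N + 1)) := by
  have := hw.strictCross_add_strict h1 hN
  simp only [steps, step, cap, mem_sigma, mem_univ, true_and, mem_range, decide_eq_true_eq]
  split_ifs at this ⊢ <;> omega

lemma step_mem_one (hw : IsWord N w pos) (hl : w (N + 1) = 0) {v : ℕ} (h1 : 1 ≤ v)
    (hN : v ≤ N) : step w pos v ∈ steps 1 (downCross w v (N + 1)) := by
  have := hw.strictCross_add_up hl h1 hN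
  simp only [steps, step, cap, mem_sigma, mem_univ, true_and, mem_range, decide_eq_true_eq]
  split_ifs <;> omega

lemma map_step_mem (hw : IsWord N w pos) {e : ℕ}
    (hs : ∀ v, 1 ≤ v → v ≤ N → step w pos v ∈ steps e (downCross w v (N + 1)))
    (r v : ℕ) (h1 : 1 ≤ v) (hv : v + r = N + 1) :
    (List.range' v r).map (step w pos) ∈ histories e r (downCross w v (N + 1)) := by
  induction r generalizing v with
  | zero =>
    obtain rfl : v = N + 1 := hv
    simp [histories, hw.downCross_top]
  | succ r ih =>
    rw [histories, mem_image]
    refine ⟨⟨step w pos v, (List.range' (v + 1) r).map (step w pos)⟩, ?_, ?_⟩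
    · rw [mem_sigma]
      refine ⟨hs v h1 (by omega), ?_⟩
      rw [hw.next_step h1 (by omega)]
      exact ih (v + 1) (by omega) (by omega)
    · simp [List.range'_succ]

lemma pos_lt_pos_of_map_step_eq {w' pos' : ℕ → ℕ} (hw : IsWord N w pos) (hw' : IsWord N w' pos')
    (h : (List.range' 1 N).map (step w pos) = (List.range' 1 N).map (step w' pos'))
    {u v : ℕ} (h1 : 1 ≤ u) (huv : u < v) (hv : v ≤ N) :
    pos v < pos u ↔ pos' v < pos' u := by
  have key : ∀ v, 1 ≤ v → v ≤ N → step w pos v = step w' pos' v := fun v h1 hN =>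
    List.map_inj_left.1 h v (by simp [List.mem_range'_1]; omega)
  simp only [step, Sigma.mk.injEq, Prod.mk.injEq, decide_eq_decide, heq_eq_eq] at key
  exact pos_lt_pos_congr hw hw' (fun v h1 h2 => (key v h1 h2).1.1)
    (fun v h1 h2 => (key v h1 h2).1.2) (fun v h1 h2 => (key v h1 h2).2) h1 huv hv

end IsWord

/-! ### The history of a permutation -/

variable {N : ℕ}

/-- The word `0 σ₁ … σ_N z`. -/
def extWord (z : ℕ) (σ : Equiv.Perm (Fin N)) (i : ℕ) : ℕ :=
  if i = N + 1 then z else entry σ i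

/-- The position of the value `v`. -/
def posOf (σ : Equiv.Perm (Fin N)) (v : ℕ) : ℕ := entry σ.symm v

lemma entry_of_mem (σ : Equiv.Perm (Fin N)) {i : ℕ} (h1 : 1 ≤ i) (hN : i ≤ N) :
    entry σ i = (σ ⟨i - 1, by omega⟩ : ℕ) + 1 := dif_pos ⟨h1, hN⟩

lemma entry_symm_entry (σ : Equiv.Perm (Fin N)) {i : ℕ} (h1 : 1 ≤ i) (hN : i ≤ N) :
    entry σ.symm (entry σ i) = i := by
  rw [entry_of_mem σ h1 hN, entry_of_mem _ (by omega) (by omega)]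
  simp
  omega

lemma extWord_of_le (z : ℕ) (σ : Equiv.Perm (Fin N)) {i : ℕ} (hi : i ≤ N) :
    extWord z σ i = entry σ i := if_neg (by omega)

lemma extWord_last (z : ℕ) (σ : Equiv.Perm (Fin N)) : extWord z σ (N + 1) = z := if_pos rfl

lemma extWord_zero (σ : Equiv.Perm (Fin N)) : extWord 0 σ = entry σ := by
  funext i
  unfold extWord
  split_ifs with h
  · rw [entry, dif_neg (by omega)]
  · rfl

lemma one_le_entry (σ : Equiv.Perm (Fin N)) {i : ℕ} (h1 : 1 ≤ i) (hN : i ≤ N) :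
    1 ≤ entry σ i := by
  rw [entry_of_mem σ h1 hN]
  omega

lemma entry_le (σ : Equiv.Perm (Fin N)) (i : ℕ) : entry σ i ≤ N := by
  unfold entry
  split_ifs with h <;> omega

lemma entry_zero (σ : Equiv.Perm (Fin N)) : entry σ 0 = 0 := dif_neg (by omega)

lemma isWord_extWord {z : ℕ} (hz : z = 0 ∨ z = N + 1) (σ : Equiv.Perm (Fin N)) :
    IsWord N (extWord z σ) (posOf σ) where
  zero := by rw [extWord_of_le z σ (by omega), entry_zero]
  one_le_pos _ h1 hN := one_le_entry _ h1 hN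
  pos_le v _ _ := entry_le _ v
  apply_pos v h1 hN := by
    rw [posOf, extWord_of_le z σ (entry_le _ v)]
    exact entry_symm_entry σ.symm h1 hN
  one_le i h1 hN := by
    rw [extWord_of_le z σ hN]
    exact one_le_entry σ h1 hN
  le i h1 hN := by
    rw [extWord_of_le z σ hN]
    exact entry_le σ i
  pos_apply i h1 hN := by
    rw [extWord_of_le z σ hN]
    exact entry_symm_entry σ h1 hN
  last := by rwa [extWord_last]

/-- The Laguerre history of a permutation followed by `z`. -/
def history (z : ℕ) (σ : Equiv.Perm (Fin N)) : List Step :=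
  (List.range' 1 N).map (IsWord.step (extWord z σ) (posOf σ))

lemma eq_of_symm_lt_iff {σ τ : Equiv.Perm (Fin N)}
    (h : ∀ u v : Fin N, u < v → (σ.symm v < σ.symm u ↔ τ.symm v < τ.symm u)) : σ = τ := by
  have h2 : ∀ u v : Fin N, σ.symm u < σ.symm v ↔ τ.symm u < τ.symm v := by
    intro u v
    rcases lt_trichotomy u v with huv | rfl | huv
    · have := h u v huv
      have a1 : σ.symm u ≠ σ.symm v := fun h => huv.ne (σ.symm.injective h)
      have a2 : τ.symm u ≠ τ.symm v := fun h => huv.ne (τ.symm.injective h)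
      constructor
      · intro h'
        by_contra hc
        exact absurd (this.2 (lt_of_le_of_ne (not_lt.1 hc) a2.symm)) h'.not_gt
      · intro h'
        by_contra hc
        exact absurd (this.1 (lt_of_le_of_ne (not_lt.1 hc) a1.symm)) h'.not_gt
    · simp
    · exact h v u huv
  have hm : StrictMono (σ.trans τ.symm) := fun i j hij => by
    have := (h2 (σ i) (σ j)).1 (by simpa using hij)
    simpa using this
  -- The finite chain `Fin N` has no order automorphism but the identity.
  have key : hm.orderIsoOfSurjective _ (σ.trans τ.symm).surjective = OrderIso.refl _ :=
    Subsingleton.elim _ _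
  refine Equiv.ext fun i => ?_
  have : τ.symm (σ i) = i := DFunLike.congr_fun key i
  exact (Equiv.symm_apply_eq τ).1 this

lemma history_injective {z : ℕ} (hz : z = 0 ∨ z = N + 1) :
    Function.Injective (history (N := N) z) := by
  intro σ τ h
  refine eq_of_symm_lt_iff fun u v huv => ?_
  have key := IsWord.pos_lt_pos_of_map_step_eq (isWord_extWord hz σ) (isWord_extWord hz τ) h
    (u := u + 1) (v := v + 1) (by omega) (by simpa using huv) (by omega)
  simpa [posOf, entry_of_mem] using key

/-- Reindexing along a bijection: an injective map into a set with N! elements. -/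
lemma sum_history_zero {M : Type*} [AddCommMonoid M] (f : List Step → M) :
    ∑ σ : Equiv.Perm (Fin N), f (history (N + 1) σ) = ∑ l ∈ histories 0 N 0, f l := by
  have hz : N + 1 = 0 ∨ N + 1 = N + 1 := Or.inr rfl
  rw [← sum_image (s := univ) (g := history (N + 1)) (history_injective hz).injOn]
  refine congrArg (fun s => ∑ l ∈ s, f l) (eq_of_subset_of_card_le ?_ ?_)
  · intro l hl
    obtain ⟨σ, -, rfl⟩ := mem_image.1 hl
    have hw := isWord_extWord hz σ
    have := hw.map_step_mem (fun v h1 h2 => hw.step_mem_zero h1 h2) N 1 le_rfl (by omega)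
    rwa [hw.downCross_one_of_last_ne (extWord_last _ σ)] at this
  · rw [card_image_of_injective _ (history_injective hz), card_histories_zero]
    simp [Fintype.card_perm]

lemma sum_history_one {M : Type*} [AddCommMonoid M] (f : List Step → M) :
    ∑ σ : Equiv.Perm (Fin (N + 1)), f (history 0 σ) = ∑ l ∈ histories 1 (N + 1) 1, f l := by
  have hz : 0 = 0 ∨ 0 = N + 1 + 1 := Or.inl rfl
  rw [← sum_image (s := univ) (g := history 0) (history_injective hz).injOn]
  refine congrArg (fun s => ∑ l ∈ s, f l) (eq_of_subset_of_card_le ?_ ?_)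
  · intro l hl
    obtain ⟨σ, -, rfl⟩ := mem_image.1 hl
    have hw := isWord_extWord hz σ
    have hl := extWord_last 0 σ
    have := hw.map_step_mem (fun v h1 h2 => hw.step_mem_one hl h1 h2) (N + 1) 1 le_rfl (by omega)
    rwa [hw.downCross_one_of_last_eq (by omega) hl] at this
  · rw [card_image_of_injective _ (history_injective hz), card_histories_one N 0]
    simp [Fintype.card_perm]

end EvenOddDrop

namespace EvenOddDrop

open Finset

/-! ### The statistics of a permutation read off its history -/

variable {N : ℕ}

lemma posOf_pos (σ : Equiv.Perm (Fin N)) {v : ℕ} (h1 : 1 ≤ v) (hN : v ≤ N) : 1 ≤ posOf σ v :=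
  one_le_entry _ h1 hN

lemma posOf_le (σ : Equiv.Perm (Fin N)) (v : ℕ) : posOf σ v ≤ N := entry_le _ v

lemma entry_posOf (σ : Equiv.Perm (Fin N)) {v : ℕ} (h1 : 1 ≤ v) (hN : v ≤ N) :
    entry σ (posOf σ v) = v := entry_symm_entry σ.symm h1 hN

lemma posOf_entry (σ : Equiv.Perm (Fin N)) {i : ℕ} (h1 : 1 ≤ i) (hN : i ≤ N) :
    posOf σ (entry σ i) = i := entry_symm_entry σ h1 hN

lemma entry_eq_iff (σ : Equiv.Perm (Fin N)) {v i : ℕ} (h1 : 1 ≤ v) (hN : v ≤ N) :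
    entry σ i = v ↔ i = posOf σ v := by
  constructor
  · rintro rfl
    have : 1 ≤ i ∧ i ≤ N := by
      by_contra h
      rw [entry, dif_neg h] at h1
      omega
    exact (posOf_entry σ this.1 this.2).symm
  · rintro rfl
    exact entry_posOf σ h1 hN

lemma bot_extWord_iff (z : ℕ) (σ : Equiv.Perm (Fin N)) (v : ℕ) :
    IsWord.Bot (extWord z σ) (posOf σ) v ↔ v < entry σ (posOf σ v - 1) := by
  have := posOf_le σ v
  rw [IsWord.Bot, extWord_of_le z σ (by omega)]

lemma top_extWord_iff (z : ℕ) (σ : Equiv.Perm (Fin N)) {v : ℕ} :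
    IsWord.Top (extWord z σ) (posOf σ) v ↔
      if posOf σ v = N then z < v else entry σ (posOf σ v + 1) < v := by
  have := posOf_le σ v
  unfold IsWord.Top extWord
  split_ifs <;> omega

/-- Any closing entry `z` is allowed, since only the part up to `v` matters. Pairs are indexed by
the descent bottom and crossings by the descent top, hence the shift by one. -/
lemma lesAt_eq (z : ℕ) (σ : Equiv.Perm (Fin N)) {v : ℕ} (h1 : 1 ≤ v) (hN : v ≤ N) :
    lesAt σ v = strictCross (extWord z σ) v (posOf σ v) := by
  have hp := posOf_le σ v
  have he := entry_posOf σ h1 hN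
  have h0 := entry_zero σ
  have : strictCross (extWord z σ) v (posOf σ v) =
      ∑ i ∈ range (posOf σ v), if entry σ (i + 1) < v ∧ v < entry σ i then 1 else 0 := by
    refine sum_congr rfl fun i hi => ?_
    have := mem_range.1 hi
    rw [extWord_of_le z σ (by omega), extWord_of_le z σ (by omega)]
  rw [this, ← card_filter]
  refine card_bij' (fun x _ => x.1 - 1) (fun i _ => (i + 1, posOf σ v)) ?_ ?_ ?_ ?_
  · rintro ⟨i, j⟩ h
    simp only [lesPairs, mem_filter, mem_product, mem_Icc, mem_range] at h ⊢
    obtain ⟨h, rfl⟩ := h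
    rw [posOf_entry σ (by omega) (by omega), Nat.sub_add_cancel (by omega)]
    omega
  · intro i h
    simp only [lesPairs, mem_filter, mem_product, mem_Icc, mem_range, Nat.add_sub_cancel] at h ⊢
    rw [he]
    have : i ≠ 0 := by
      rintro rfl
      omega
    have : i + 1 ≠ posOf σ v := fun h' => by
      rw [h'] at h
      omega
    omega
  · rintro ⟨i, j⟩ h
    simp only [lesPairs, mem_filter, mem_product, mem_Icc] at h
    obtain ⟨h, rfl⟩ := h
    rw [posOf_entry σ (by omega) (by omega)]
    ext <;> simp
    omega
  · intro i _
    simp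

lemma ressAt_eq (σ : Equiv.Perm (Fin N)) {v : ℕ} (h1 : 1 ≤ v) (hN : v ≤ N) :
    ressAt σ v = ∑ i ∈ Ico (posOf σ v) (N + 1),
      if extWord (N + 1) σ (i + 1) < v ∧ v < extWord (N + 1) σ i then 1 else 0 := by
  have hp := posOf_pos σ h1 hN
  have hp' := posOf_le σ v
  have he := entry_posOf σ h1 hN
  rw [← card_filter]
  refine card_bij' (fun x _ => x.2) (fun i _ => (posOf σ v, i)) ?_ ?_ ?_ ?_
  · rintro ⟨i, j⟩ h
    simp only [ressPairs, mem_filter, mem_product, mem_Icc, mem_Ico] at h ⊢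
    obtain ⟨h, rfl⟩ := h
    rw [posOf_entry σ (by omega) (by omega), extWord_of_le _ σ (by omega),
      extWord_of_le _ σ (by omega)]
    omega
  · intro i h
    simp only [ressPairs, mem_filter, mem_product, mem_Icc, mem_Ico] at h ⊢
    have hi : i ≠ N := by
      rintro rfl
      rw [extWord_last] at h
      omega
    rw [extWord_of_le _ σ (by omega), extWord_of_le _ σ (by omega)] at h
    have : i ≠ posOf σ v := by
      rintro rfl
      omega
    rw [he]
    omega
  · rintro ⟨i, j⟩ h
    simp only [ressPairs, mem_filter, mem_product, mem_Icc] at h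
    obtain ⟨h, rfl⟩ := h
    rw [posOf_entry σ (by omega) (by omega)]
  · intro i _
    rfl

/-- The weak inequality is harmless, as `v` does not recur on its right, and the closing 0 creates
no ascent. -/
lemma resAt_eq (σ : Equiv.Perm (Fin N)) {v : ℕ} (h1 : 1 ≤ v) (hN : v ≤ N) :
    resAt σ v = ∑ i ∈ Ico (posOf σ v) (N + 1),
      if extWord 0 σ i < v ∧ v ≤ extWord 0 σ (i + 1) then 1 else 0 := by
  have hp := posOf_pos σ h1 hN
  have hp' := posOf_le σ v
  have he := entry_posOf σ h1 hN
  rw [← card_filter]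
  refine card_bij' (fun x _ => x.2) (fun i _ => (posOf σ v, i)) ?_ ?_ ?_ ?_
  · rintro ⟨i, j⟩ h
    simp only [resPairs, mem_filter, mem_product, mem_Icc, mem_Ico] at h ⊢
    obtain ⟨h, rfl⟩ := h
    rw [posOf_entry σ (by omega) (by omega), extWord_of_le _ σ (by omega),
      extWord_of_le _ σ (by omega)]
    omega
  · intro i h
    simp only [resPairs, mem_filter, mem_product, mem_Icc, mem_Ico] at h ⊢
    have hi : i ≠ N := by
      rintro rfl
      rw [extWord_last] at h
      omega
    rw [extWord_of_le _ σ (by omega), extWord_of_le _ σ (by omega)] at h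
    have : i ≠ posOf σ v := by
      rintro rfl
      omega
    have hne : entry σ (i + 1) ≠ v := fun h' => by
      have := (entry_eq_iff σ h1 hN).1 h'
      omega
    rw [he]
    omega
  · rintro ⟨i, j⟩ h
    simp only [resPairs, mem_filter, mem_product, mem_Icc] at h
    obtain ⟨h, rfl⟩ := h
    rw [posOf_entry σ (by omega) (by omega)]
  · intro i _
    rfl

lemma entry_mem_Icc (σ : Equiv.Perm (Fin N)) {i : ℕ} (hi : i ∈ Icc 1 N) :
    entry σ i ∈ Icc 1 N := by
  rw [mem_Icc] at hi ⊢
  exact ⟨one_le_entry σ hi.1 hi.2, entry_le σ i⟩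

lemma les_eq_sum (σ : Equiv.Perm (Fin N)) : les σ = ∑ v ∈ Icc 1 N, lesAt σ v :=
  card_eq_sum_card_fiberwise fun x hx => by
    simp only [lesPairs, coe_filter, Set.mem_ofPred_eq, mem_product] at hx
    exact entry_mem_Icc σ hx.1.2

lemma ress_eq_sum (σ : Equiv.Perm (Fin N)) : ress σ = ∑ v ∈ Icc 1 N, ressAt σ v :=
  card_eq_sum_card_fiberwise fun x hx => by
    simp only [ressPairs, coe_filter, Set.mem_ofPred_eq, mem_product] at hx
    exact entry_mem_Icc σ hx.1.1

lemma res_eq_sum (σ : Equiv.Perm (Fin N)) : res σ = ∑ v ∈ Icc 1 N, resAt σ v :=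
  card_eq_sum_card_fiberwise fun x hx => by
    simp only [resPairs, coe_filter, Set.mem_ofPred_eq, mem_product] at hx
    exact entry_mem_Icc σ hx.1.1

lemma sum_entry {M : Type*} [AddCommMonoid M] (σ : Equiv.Perm (Fin N)) (f : ℕ → M) :
    ∑ i ∈ Icc 1 N, f (entry σ i) = ∑ v ∈ Icc 1 N, f v := by
  refine sum_bij' (fun i _ => entry σ i) (fun v _ => posOf σ v) (fun i hi => entry_mem_Icc σ hi)
    (fun v hv => entry_mem_Icc _ hv) ?_ ?_ fun _ _ => rfl
  · intro i hi
    rw [mem_Icc] at hi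
    exact posOf_entry σ hi.1 hi.2
  · intro v hv
    rw [mem_Icc] at hv
    exact entry_posOf σ hv.1 hv.2

lemma lema_eq_sum {z : ℕ} (hz : z = 0 ∨ z = N + 1) (σ : Equiv.Perm (Fin N)) :
    lema σ = ∑ v ∈ Icc 1 N, if Even v ∧ ¬ IsWord.Bot (extWord z σ) (posOf σ) v ∧
      strictCross (extWord z σ) v (posOf σ v) = 0 then 1 else 0 := by
  rw [lema, card_filter]
  refine Eq.trans ?_ (sum_entry σ _)
  refine sum_congr rfl fun i hi => ?_
  have hi' := mem_Icc.1 hi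
  have hv := mem_Icc.1 (entry_mem_Icc σ hi)
  refine if_congr ?_ rfl rfl
  rw [← (isWord_extWord hz σ).forall_lt_iff hv.1 hv.2, posOf_entry σ hi'.1 hi'.2, and_comm]
  refine and_congr_right fun _ => forall₂_congr fun j hj => ?_
  have := mem_Ico.1 hj
  rw [extWord_of_le z σ (by omega)]

lemma des_eq_sum (z : ℕ) (σ : Equiv.Perm (Fin N)) :
    des σ = ∑ v ∈ Icc 1 N, if IsWord.Bot (extWord z σ) (posOf σ) v then 1 else 0 := by
  rw [← card_filter]
  refine card_bij' (fun i _ => entry σ (i + 1)) (fun v _ => posOf σ v - 1) ?_ ?_ ?_ ?_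
  · intro i h
    simp only [mem_filter, mem_Ico] at h
    rw [mem_filter, bot_extWord_iff, posOf_entry σ (by omega) (by omega)]
    exact ⟨entry_mem_Icc σ (mem_Icc.2 ⟨by omega, by omega⟩), h.2⟩
  · intro v h
    simp only [mem_filter, mem_Icc, bot_extWord_iff] at h
    have hp := posOf_pos σ h.1.1 h.1.2
    have hp' := posOf_le σ v
    have h0 := entry_zero σ
    rw [mem_filter, mem_Ico, Nat.sub_add_cancel hp, entry_posOf σ h.1.1 h.1.2]
    have : posOf σ v - 1 ≠ 0 := fun h' => by
      rw [h'] at h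
      omega
    omega
  · intro i h
    simp only [mem_filter, mem_Ico] at h
    rw [posOf_entry σ (by omega) (by omega)]
    rfl
  · intro v h
    simp only [mem_filter, mem_Icc] at h
    rw [Nat.sub_add_cancel (posOf_pos σ h.1.1 h.1.2), entry_posOf σ h.1.1 h.1.2]

lemma isDescentBottom_iff (z : ℕ) (σ : Equiv.Perm (Fin N)) {v : ℕ} (h1 : 1 ≤ v) (hN : v ≤ N) :
    IsDescentBottom σ v ↔ IsWord.Bot (extWord z σ) (posOf σ) v := by
  rw [bot_extWord_iff]
  have hp := posOf_pos σ h1 hN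
  have hp' := posOf_le σ v
  have h0 := entry_zero σ
  constructor
  · rintro ⟨i, hi, rfl, h⟩
    rw [mem_Ico] at hi
    rwa [posOf_entry σ (by omega) (by omega)]
  · intro h
    have : posOf σ v - 1 ≠ 0 := fun h' => by
      rw [h'] at h
      omega
    refine ⟨posOf σ v - 1, mem_Ico.2 ⟨by omega, by omega⟩, ?_⟩
    rw [Nat.sub_add_cancel hp, entry_posOf σ h1 hN]
    exact ⟨rfl, h⟩

lemma isDescentTop_iff (σ : Equiv.Perm (Fin N)) {v : ℕ} (h1 : 1 ≤ v) (hN : v ≤ N) :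
    IsDescentTop σ v ↔ IsWord.Top (extWord (N + 1) σ) (posOf σ) v := by
  rw [top_extWord_iff]
  have hp := posOf_pos σ h1 hN
  have hp' := posOf_le σ v
  constructor
  · rintro ⟨i, hi, rfl, h⟩
    rw [mem_Ico] at hi
    rwa [posOf_entry σ (by omega) (by omega), if_neg (by omega)]
  · intro h
    split_ifs at h
    · omega
    · refine ⟨posOf σ v, mem_Ico.2 ⟨by omega, by omega⟩, ?_⟩
      rw [entry_posOf σ h1 hN]
      exact ⟨rfl, h⟩

/-- The height before the value `v` is inserted. -/
def height (z : ℕ) (σ : Equiv.Perm (Fin N)) (v : ℕ) : ℕ := downCross (extWord z σ) v (N + 1)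

/-- The step inserting the value `v`. -/
def stepOf (z : ℕ) (σ : Equiv.Perm (Fin N)) (v : ℕ) : Step :=
  IsWord.step (extWord z σ) (posOf σ) v

lemma lesAt_eq_stepOf (z : ℕ) (σ : Equiv.Perm (Fin N)) {v : ℕ} (h1 : 1 ≤ v) (hN : v ≤ N) :
    lesAt σ v = (stepOf z σ v).2 := lesAt_eq z σ h1 hN

lemma ressAt_eq_sub (σ : Equiv.Perm (Fin N)) {v : ℕ} (h1 : 1 ≤ v) (hN : v ≤ N) :
    ressAt σ v = height (N + 1) σ v - (stepOf (N + 1) σ v).1.2.toNat - (stepOf (N + 1) σ v).2 := by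
  have := (isWord_extWord (Or.inr rfl) σ).strictCross_add_strict h1 hN
  rw [← ressAt_eq σ h1 hN] at this
  simp only [height, stepOf, IsWord.step]
  by_cases ht : IsWord.Top (extWord (N + 1) σ) (posOf σ) v <;> simp [ht] at this ⊢ <;> omega

lemma resAt_eq_sub (σ : Equiv.Perm (Fin N)) {v : ℕ} (h1 : 1 ≤ v) (hN : v ≤ N) :
    resAt σ v = height 0 σ v - 1 - (stepOf 0 σ v).2 := by
  have := (isWord_extWord (Or.inl rfl) σ).strictCross_add_up (extWord_last 0 σ) h1 hN
  rw [← resAt_eq σ h1 hN] at this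
  simp only [height, stepOf, IsWord.step]
  omega

lemma lema_eq_sum_stepOf {z : ℕ} (hz : z = 0 ∨ z = N + 1) (σ : Equiv.Perm (Fin N)) :
    lema σ = ∑ v ∈ Icc 1 N,
      if Even v ∧ (stepOf z σ v).1.1 = false ∧ (stepOf z σ v).2 = 0 then 1 else 0 := by
  rw [lema_eq_sum hz]
  simp [stepOf, IsWord.step]

lemma des_eq_sum_stepOf (z : ℕ) (σ : Equiv.Perm (Fin N)) :
    des σ = ∑ v ∈ Icc 1 N, (stepOf z σ v).1.1.toNat := by
  rw [des_eq_sum z]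
  refine sum_congr rfl fun v _ => ?_
  by_cases h : IsWord.Bot (extWord z σ) (posOf σ) v <;> simp [stepOf, IsWord.step, h]

lemma stepOf_bot_iff (z : ℕ) (σ : Equiv.Perm (Fin N)) (v : ℕ) :
    (stepOf z σ v).1.1 = true ↔ IsWord.Bot (extWord z σ) (posOf σ) v := by
  simp [stepOf, IsWord.step]

lemma stepOf_top_iff (z : ℕ) (σ : Equiv.Perm (Fin N)) (v : ℕ) :
    (stepOf z σ v).1.2 = true ↔ IsWord.Top (extWord z σ) (posOf σ) v := by
  simp [stepOf, IsWord.step]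

lemma height_succ {z : ℕ} (hz : z = 0 ∨ z = N + 1) (σ : Equiv.Perm (Fin N)) {v : ℕ}
    (h1 : 1 ≤ v) (hN : v ≤ N) : height z σ (v + 1) = next (height z σ v) (stepOf z σ v).1 :=
  ((isWord_extWord hz σ).next_step h1 hN).symm

lemma height_succ_add {z : ℕ} (hz : z = 0 ∨ z = N + 1) (σ : Equiv.Perm (Fin N)) {v : ℕ}
    (h1 : 1 ≤ v) (hN : v ≤ N) :
    height z σ (v + 1) + (stepOf z σ v).1.2.toNat =
      height z σ v + (stepOf z σ v).1.1.toNat := by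
  have := (isWord_extWord hz σ).downCross_succ_add h1 hN
  simp only [height, stepOf, IsWord.step]
  by_cases hb : IsWord.Bot (extWord z σ) (posOf σ) v <;>
    by_cases ht : IsWord.Top (extWord z σ) (posOf σ) v <;> simp [hb, ht] at this ⊢ <;> omega

lemma height_one_of_ne (σ : Equiv.Perm (Fin N)) : height (N + 1) σ 1 = 0 :=
  (isWord_extWord (Or.inr rfl) σ).downCross_one_of_last_ne (extWord_last _ σ)

lemma height_one_of_eq (σ : Equiv.Perm (Fin (N + 1))) : height 0 σ 1 = 1 :=
  (isWord_extWord (Or.inl rfl) σ).downCross_one_of_last_eq (by omega) (extWord_last _ σ)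

/-! ### Characterization of `E`-permutations -/

lemma isEvenOddDescent_iff (σ : Equiv.Perm (Fin N)) :
    IsEvenOddDescent σ ↔ ∀ v ∈ Icc 1 N,
      ((stepOf (N + 1) σ v).1.1 = true → Odd v) ∧ ((stepOf (N + 1) σ v).1.2 = true → Even v) := by
  constructor
  · intro h v hv
    rw [mem_Icc] at hv
    rw [stepOf_bot_iff, stepOf_top_iff, ← isDescentTop_iff σ hv.1 hv.2,
      ← isDescentBottom_iff _ σ hv.1 hv.2]
    constructor
    · rintro ⟨i, hi, rfl, hlt⟩
      exact (h i hi hlt).2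
    · rintro ⟨i, hi, rfl, hlt⟩
      exact (h i hi hlt).1
  · intro h i hi hlt
    have hi' := mem_Ico.1 hi
    have m1 := entry_mem_Icc σ (i := i) (mem_Icc.2 ⟨by omega, by omega⟩)
    have m2 := entry_mem_Icc σ (i := i + 1) (mem_Icc.2 ⟨by omega, by omega⟩)
    have a1 := (h _ m1).2
    have a2 := (h _ m2).1
    rw [mem_Icc] at m1 m2
    rw [stepOf_top_iff, ← isDescentTop_iff σ m1.1 m1.2] at a1
    rw [stepOf_bot_iff, ← isDescentBottom_iff _ σ m2.1 m2.2] at a2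
    exact ⟨a1 ⟨i, hi, rfl, hlt⟩, a2 ⟨i, hi, rfl, hlt⟩⟩

lemma forall_Icc_two_mul {n : ℕ} {P : ℕ → Prop} :
    (∀ v ∈ Icc 1 (2 * n), P v) ↔ ∀ j ∈ range n, P (2 * j + 1) ∧ P (2 * j + 2) := by
  constructor
  · intro h j hj
    rw [mem_range] at hj
    exact ⟨h _ (mem_Icc.2 ⟨by omega, by omega⟩), h _ (mem_Icc.2 ⟨by omega, by omega⟩)⟩
  · intro h v hv
    rw [mem_Icc] at hv
    have := h ((v - 1) / 2) (mem_range.2 (by omega))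
    rcases Nat.even_or_odd' v with ⟨k, rfl | rfl⟩
    · obtain ⟨k, rfl⟩ : ∃ m, k = m + 1 := ⟨k - 1, by omega⟩
      rw [show (2 * (k + 1) - 1) / 2 = k by omega] at this
      exact this.2
    · rw [show (2 * k + 1 - 1) / 2 = k by omega] at this
      exact this.1

lemma forall_Icc_one {n : ℕ} {P : ℕ → Prop} :
    (∀ j ∈ Icc 1 n, P j) ↔ ∀ j ∈ range n, P (j + 1) := by
  constructor
  · intro h j hj
    rw [mem_range] at hj
    exact h _ (mem_Icc.2 ⟨by omega, by omega⟩)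
  · intro h v hv
    rw [mem_Icc] at hv
    have := h (v - 1) (mem_range.2 (by omega))
    rwa [Nat.sub_add_cancel hv.1] at this

/-- The steps of the values `2j - 1`, `2j` allowed in an `E`-permutation. -/
abbrev EPair (s s' : Step) : Prop :=
  s.1.2 = false ∧ s'.1.1 = false ∧ ¬ (s.1.1 = true ∧ s'.1.2 = true)

lemma isEPerm_iff (n : ℕ) (σ : Equiv.Perm (Fin (2 * n))) :
    IsEPerm n σ ↔ ∀ j ∈ range n,
      EPair (stepOf (2 * n + 1) σ (2 * j + 1)) (stepOf (2 * n + 1) σ (2 * j + 2)) := by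
  rw [IsEPerm, isEvenOddDescent_iff, forall_Icc_two_mul, forall_Icc_one, ← forall₂_and]
  refine forall₂_congr fun j hj => ?_
  rw [mem_range] at hj
  rw [show 2 * (j + 1) - 1 = 2 * j + 1 by omega, show 2 * (j + 1) = 2 * j + 2 by omega,
    isDescentTop_iff σ (by omega) (by omega),
    isDescentBottom_iff (2 * n + 1) σ (by omega) (by omega), ← stepOf_bot_iff, ← stepOf_top_iff]
  have o1 : Odd (2 * j + 1) := odd_two_mul_add_one j
  have e1 : ¬ Even (2 * j + 1) := Nat.not_even_iff_odd.2 o1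
  have e2 : Even (2 * j + 2) := ⟨j + 1, by ring⟩
  have o2 : ¬ Odd (2 * j + 2) := Nat.not_odd_iff_even.2 e2
  simp only [o1, e1, e2, o2, EPair, imp_true_iff, imp_false, true_and, and_true,
    Bool.not_eq_true]
  tauto

lemma card_filter_lt_succ (P : ℕ → Prop) [DecidablePred P] {x : ℕ} (h1 : 1 ≤ x) (hN : x ≤ N) :
    ((Icc 1 N).filter fun v => P v ∧ v < x + 1).card =
      ((Icc 1 N).filter fun v => P v ∧ v < x).card + if P x then 1 else 0 := by
  have : ∑ v ∈ Icc 1 N, (if v = x then if P v then 1 else 0 else 0) = if P x then 1 else 0 := by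
    rw [sum_ite_eq', if_pos (mem_Icc.2 ⟨h1, hN⟩)]
  rw [card_filter, card_filter, ← this, ← sum_add_distrib]
  refine sum_congr rfl fun v _ => ?_
  by_cases hv : v = x
  · simp [hv]
  · simp [hv, show v < x + 1 ↔ v < x by omega]

lemma card_filter_lt_one (P : ℕ → Prop) [DecidablePred P] :
    ((Icc 1 N).filter fun v => P v ∧ v < 1).card = 0 := by
  rw [card_eq_zero, filter_eq_empty_iff]
  intro v hv
  rw [mem_Icc] at hv
  omega

/-- Expresses the height through the counts in the problem: odd minus even elements of the signature
for E, valleys minus peaks for F. -/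
lemma height_eq_of_recursion {z : ℕ} (hz : z = 0 ∨ z = N + 1) (σ : Equiv.Perm (Fin N))
    (P Q : ℕ → Prop) [DecidablePred P] [DecidablePred Q]
    (h : ∀ v ∈ Icc 1 N, ((if P v then 1 else 0) - (if Q v then 1 else 0) : ℤ) =
      (stepOf z σ v).1.1.toNat - (stepOf z σ v).1.2.toNat) {x : ℕ} (h1 : 1 ≤ x)
    (hN : x ≤ N + 1) :
    (((Icc 1 N).filter fun v => P v ∧ v < x).card : ℤ) -
      (((Icc 1 N).filter fun v => Q v ∧ v < x).card : ℤ) + height z σ 1 = height z σ x := by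
  induction x, h1 using Nat.le_induction with
  | base => simp only [card_filter_lt_one, sub_self, Nat.cast_zero, zero_add]
  | succ x h1 ih =>
    have ih := ih (by omega)
    have h := h x (mem_Icc.2 ⟨h1, by omega⟩)
    have e := height_succ_add hz σ h1 (by omega)
    rw [card_filter_lt_succ P h1 (by omega), card_filter_lt_succ Q h1 (by omega)]
    push_cast
    zify at e
    linarith

lemma mem_signature_iff (σ : Equiv.Perm (Fin N)) {v : ℕ} (h1 : 1 ≤ v) (hN : v ≤ N) :
    v ∈ signature σ ↔ (stepOf (N + 1) σ v).1.1 = true ∨ (stepOf (N + 1) σ v).1.2 = true := by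
  rw [signature, mem_filter, mem_Icc, isDescentTop_iff σ h1 hN,
    isDescentBottom_iff (N + 1) σ h1 hN, stepOf_bot_iff, stepOf_top_iff]
  tauto

lemma sig_eq {σ : Equiv.Perm (Fin N)} (hσ : IsEvenOddDescent σ) {x : ℕ} (h1 : 1 ≤ x)
    (hN : x ≤ N) :
    sig σ x = height (N + 1) σ x +
      if (x ∈ signature σ ∧ Odd x) ∨ x ∉ signature σ then 1 else 0 := by
  rw [isEvenOddDescent_iff] at hσ
  have key := height_eq_of_recursion (Or.inr rfl) σ (fun v => v ∈ signature σ ∧ Odd v)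
    (fun v => v ∈ signature σ ∧ Even v) (fun v hv => ?_) h1 (by omega)
  · rw [height_one_of_ne, Nat.cast_zero, add_zero] at key
    rw [sig, ← key]
    congr 4
    · ext v
      simp only [mem_filter, mem_Icc, signature]
      tauto
    · ext v
      simp only [mem_filter, mem_Icc, signature]
      tauto
  · have h := hσ v hv
    rw [mem_Icc] at hv
    simp only [mem_signature_iff σ hv.1 hv.2]
    rcases Nat.even_or_odd v with he | ho
    · have := Nat.not_odd_iff_even.2 he
      have hb : (stepOf (N + 1) σ v).1.1 = false := by simpa [this] using h.1
      simp only [this, he, hb]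
      cases (stepOf (N + 1) σ v).1.2 <;> simp
    · have := Nat.not_even_iff_odd.2 ho
      have hb : (stepOf (N + 1) σ v).1.2 = false := by simpa [this] using h.2
      simp only [this, ho, hb]
      cases (stepOf (N + 1) σ v).1.1 <;> simp

/-- The normalization condition of `E`-permutations. -/
def ENormal (h : ℕ) (s s' : Step) : Prop :=
  (s.1.1 = true → Even h → Even s'.2) ∧ (s.1.1 = true → Odd h → Even s.2) ∧
    (s'.1.2 = true → Odd h → Even (h - s.2)) ∧ (s'.1.2 = true → Even h → Even (h - 1 - s'.2))

instance (h : ℕ) (s s' : Step) : Decidable (ENormal h s s') := by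
  unfold ENormal
  infer_instance

lemma isNormalizedEPerm_iff (n : ℕ) (σ : Equiv.Perm (Fin (2 * n))) :
    IsNormalizedEPerm n σ ↔ IsEPerm n σ ∧ ∀ j ∈ range n,
      ENormal (height (2 * n + 1) σ (2 * j + 1)) (stepOf (2 * n + 1) σ (2 * j + 1))
        (stepOf (2 * n + 1) σ (2 * j + 2)) := by
  refine and_congr_right fun hσ => ?_
  rw [forall_Icc_one]
  refine forall₂_congr fun j hj => ?_
  have hE := (isEPerm_iff n σ).1 hσ j hj
  rw [mem_range] at hj
  obtain ⟨t1, b2, hbt⟩ := hE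
  have hh := height_succ_add (Or.inr rfl) σ (v := 2 * j + 1) (by omega) (by omega)
  rw [show 2 * (j + 1) - 1 = 2 * j + 1 by omega, show 2 * (j + 1) = 2 * j + 2 by omega,
    sig_eq hσ.1 (by omega) (by omega), sig_eq hσ.1 (by omega) (by omega),
    lesAt_eq_stepOf (2 * n + 1) σ (by omega) (by omega),
    lesAt_eq_stepOf (2 * n + 1) σ (by omega) (by omega), ressAt_eq_sub σ (by omega) (by omega),
    ressAt_eq_sub σ (by omega) (by omega)]
  have m1 := mem_signature_iff σ (v := 2 * j + 1) (by omega) (by omega)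
  have m2 := mem_signature_iff σ (v := 2 * j + 2) (by omega) (by omega)
  have o1 : Odd (2 * j + 1) := odd_two_mul_add_one j
  have o2 : ¬ Odd (2 * j + 2) := Nat.not_odd_iff_even.2 ⟨j + 1, by ring⟩
  rw [t1] at hh
  simp only [m1, m2, t1, b2, o1, o2, ENormal, Bool.false_eq_true, or_false, false_or, and_true,
    and_false, em, if_true, Bool.toNat_false, Nat.sub_zero, add_zero] at hh ⊢
  generalize stepOf (2 * n + 1) σ (2 * j + 1) = s at *
  generalize stepOf (2 * n + 1) σ (2 * j + 2) = s' at *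
  rw [show 2 * j + 1 + 1 = 2 * j + 2 from rfl] at hh
  rw [hh]
  generalize height (2 * n + 1) σ (2 * j + 1) = h at *
  -- At 2j-1 the signature function is the height plus one, so the parity flips. At 2j, if it is a
  -- descent top, 2j-1 is no bottom and the value is the height `h` itself.
  have c1 : Odd ((h : ℤ) + 1) ↔ Even h := by
    rw [← Int.not_even_iff_odd, Int.even_add_one, not_not, Int.even_coe_nat]
  have c2 : Even ((h : ℤ) + 1) ↔ Odd h := by
    rw [Int.even_add_one, Int.not_even_iff_odd, Int.odd_coe_nat]
  rw [c1, c2]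
  refine and_congr_right fun _ => and_congr_right fun _ => ?_
  rcases hs' : s'.1.2 with _ | _
  · simp
  · have hs : s.1.1 = false := by simpa [hs'] using hbt
    simp [hs]

/-! ### Characterization of `F`-permutations -/

lemma entry_succ_last (σ : Equiv.Perm (Fin N)) : entry σ (N + 1) = 0 := dif_neg (by omega)

lemma stepOf_zero_bot_iff (σ : Equiv.Perm (Fin N)) (v : ℕ) :
    (stepOf 0 σ v).1.1 = true ↔ v < entry σ (posOf σ v - 1) := by
  rw [stepOf_bot_iff, extWord_zero]
  rfl

lemma stepOf_zero_top_iff (σ : Equiv.Perm (Fin N)) (v : ℕ) :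
    (stepOf 0 σ v).1.2 = true ↔ entry σ (posOf σ v + 1) < v := by
  rw [stepOf_top_iff, extWord_zero]
  rfl

lemma entry_pred_ne (σ : Equiv.Perm (Fin N)) {v : ℕ} (h1 : 1 ≤ v) (hN : v ≤ N) :
    entry σ (posOf σ v - 1) ≠ v := fun h => by
  have := (entry_eq_iff σ h1 hN).1 h
  have := posOf_pos σ h1 hN
  omega

lemma entry_succ_ne (σ : Equiv.Perm (Fin N)) {v : ℕ} (h1 : 1 ≤ v) (hN : v ≤ N) :
    entry σ (posOf σ v + 1) ≠ v := fun h => by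
  have := (entry_eq_iff σ h1 hN).1 h
  omega

lemma exists_entry_iff (σ : Equiv.Perm (Fin N)) {v : ℕ} (h1 : 1 ≤ v) (hN : v ≤ N)
    (P : ℕ → ℕ → ℕ → Prop) :
    (∃ i ∈ Icc 1 N, entry σ i = v ∧ P (entry σ i) (entry σ (i - 1)) (entry σ (i + 1))) ↔
      P v (entry σ (posOf σ v - 1)) (entry σ (posOf σ v + 1)) := by
  constructor
  · rintro ⟨i, -, he, h⟩
    rw [he] at h
    rwa [← (entry_eq_iff σ h1 hN).1 he]
  · intro h
    refine ⟨posOf σ v, mem_Icc.2 ⟨posOf_pos σ h1 hN, posOf_le σ v⟩, entry_posOf σ h1 hN, ?_⟩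
    rwa [entry_posOf σ h1 hN]

lemma isPeak_iff (σ : Equiv.Perm (Fin N)) {v : ℕ} (h1 : 1 ≤ v) (hN : v ≤ N) :
    IsPeak σ v ↔ (stepOf 0 σ v).1.1 = false ∧ (stepOf 0 σ v).1.2 = true := by
  have := entry_pred_ne σ h1 hN
  rw [← Bool.not_eq_true, stepOf_zero_bot_iff, stepOf_zero_top_iff, IsPeak,
    exists_entry_iff σ h1 hN fun a b c => b < a ∧ c < a]
  omega

lemma isValley_iff (σ : Equiv.Perm (Fin N)) {v : ℕ} (h1 : 1 ≤ v) (hN : v ≤ N) :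
    IsValley σ v ↔ (stepOf 0 σ v).1.1 = true ∧ (stepOf 0 σ v).1.2 = false := by
  have := entry_succ_ne σ h1 hN
  rw [← Bool.not_eq_true, stepOf_zero_bot_iff, stepOf_zero_top_iff, IsValley,
    exists_entry_iff σ h1 hN fun a b c => a < b ∧ a < c]
  omega

lemma isDoubleDescent_iff (σ : Equiv.Perm (Fin N)) {v : ℕ} (h1 : 1 ≤ v) (hN : v ≤ N) :
    IsDoubleDescent σ v ↔ (stepOf 0 σ v).1.1 = true ∧ (stepOf 0 σ v).1.2 = true := by
  rw [stepOf_zero_bot_iff, stepOf_zero_top_iff, IsDoubleDescent,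
    exists_entry_iff σ h1 hN fun a b c => a < b ∧ c < a]

/-- The closing 0 turns the last entry into a descent top, which absorbs the condition that it be
odd. -/
lemma isOddOddDescent_and_iff (σ : Equiv.Perm (Fin (N + 1))) :
    IsOddOddDescent σ ∧ Odd (entry σ (N + 1)) ↔ ∀ v ∈ Icc 1 (N + 1),
      ((stepOf 0 σ v).1.1 = true ∨ (stepOf 0 σ v).1.2 = true) → Odd v := by
  simp only [stepOf_zero_bot_iff, stepOf_zero_top_iff]
  constructor
  · rintro ⟨h, hl⟩ v hv hbt
    rw [mem_Icc] at hv
    have hp := posOf_pos σ hv.1 hv.2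
    have hp' := posOf_le σ v
    have he := entry_posOf σ hv.1 hv.2
    rcases hbt with hb | ht
    · have h0 := entry_zero σ
      have : posOf σ v - 1 ≠ 0 := fun h' => by
        rw [h'] at hb
        omega
      have := h (posOf σ v - 1) (mem_Ico.2 ⟨by omega, by omega⟩)
      rw [Nat.sub_add_cancel hp, he] at this
      exact (this hb).2
    · rcases hp'.eq_or_lt with h' | h'
      · rw [h'] at he
        rwa [he] at hl
      · have := h (posOf σ v) (mem_Ico.2 ⟨hp, h'⟩)
        rw [he] at this
        exact (this ht).1
  · intro h
    have h' : ∀ i ∈ Icc 1 (N + 1), entry σ i < entry σ (i - 1) ∨ entry σ (i + 1) < entry σ i →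
        Odd (entry σ i) := fun i hi => by
      have := h _ (entry_mem_Icc σ hi)
      rw [mem_Icc] at hi
      rwa [posOf_entry σ hi.1 hi.2] at this
    refine ⟨fun i hi hlt => ?_, ?_⟩
    · rw [mem_Ico] at hi
      refine ⟨h' i (mem_Icc.2 ⟨by omega, by omega⟩) (Or.inr hlt), ?_⟩
      exact h' (i + 1) (mem_Icc.2 ⟨by omega, by omega⟩) (Or.inl hlt)
    · refine h' (N + 1) (mem_Icc.2 ⟨by omega, le_rfl⟩) (Or.inr ?_)
      rw [entry_succ_last]
      exact one_le_entry σ (by omega) le_rfl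

/-- The steps of the values `2j - 1`, `2j` allowed in an `F`-permutation. -/
abbrev FPair (s s' : Step) : Prop :=
  s'.1.1 = false ∧ s'.1.2 = false ∧ ¬ (s.1.1 = true ∧ s.1.2 = true)

lemma isFPerm_iff (n : ℕ) (σ : Equiv.Perm (Fin (2 * n + 1))) :
    IsFPerm n σ ↔ ∀ j ∈ range n,
      FPair (stepOf 0 σ (2 * j + 1)) (stepOf 0 σ (2 * j + 2)) := by
  have hI : ∀ {P : ℕ → Prop}, (∀ v ∈ Icc 1 (2 * n + 1), P v) ↔
      (∀ j ∈ range n, P (2 * j + 1) ∧ P (2 * j + 2)) ∧ P (2 * n + 1) := by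
    intro P
    rw [← forall_Icc_two_mul]
    refine ⟨fun h => ⟨fun v hv => h v ?_, h _ ?_⟩, fun h v hv => ?_⟩
    · rw [mem_Icc] at hv ⊢
      omega
    · rw [mem_Icc]
      omega
    · rw [mem_Icc] at hv
      rcases hv.2.eq_or_lt with rfl | hlt
      · exact h.2
      · exact h.1 v (mem_Icc.2 ⟨hv.1, by omega⟩)
  have hlast : (stepOf 0 σ (2 * n + 1)).1.1 = false := by
    rw [← Bool.not_eq_true, stepOf_zero_bot_iff]
    have := entry_le σ (posOf σ (2 * n + 1) - 1)
    omega
  -- The last entry is followed by 0, so it is a peak or a double descent; the peak condition is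
  -- redundant.
  have hpeak : (∀ v ∈ Icc 1 (2 * n + 1), ¬ IsDoubleDescent σ v) →
      IsPeak σ (entry σ (2 * n + 1)) := fun h => by
    have hm := entry_mem_Icc σ (i := 2 * n + 1) (mem_Icc.2 ⟨by omega, le_rfl⟩)
    have h := h _ hm
    rw [mem_Icc] at hm
    rw [isDoubleDescent_iff σ hm.1 hm.2] at h
    have ht : (stepOf 0 σ (entry σ (2 * n + 1))).1.2 = true := by
      rw [stepOf_zero_top_iff, posOf_entry σ (by omega) le_rfl, entry_succ_last]
      exact hm.1
    rw [isPeak_iff σ hm.1 hm.2]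
    simpa [ht] using h
  have hdd : (∀ v ∈ Icc 1 (2 * n + 1), ¬ IsDoubleDescent σ v) ↔ ∀ v ∈ Icc 1 (2 * n + 1),
      ¬ ((stepOf 0 σ v).1.1 = true ∧ (stepOf 0 σ v).1.2 = true) :=
    forall₂_congr fun v hv => by
      rw [mem_Icc] at hv
      rw [isDoubleDescent_iff σ hv.1 hv.2]
  rw [IsFPerm, and_iff_left_of_imp (a := ∀ v ∈ _, _) hpeak, ← and_assoc,
    isOddOddDescent_and_iff, hdd, hI, hI]
  have o1 (j : ℕ) : Odd (2 * j + 1) := odd_two_mul_add_one j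
  have o2 (j : ℕ) : ¬ Odd (2 * j + 2) := Nat.not_odd_iff_even.2 ⟨j + 1, by ring⟩
  simp only [o1, o2, imp_true_iff, imp_false, true_and, and_true, not_or, Bool.not_eq_true]
  constructor
  · rintro ⟨h1, h2, -⟩ j hj
    exact ⟨(h1 j hj).1, (h1 j hj).2, (h2 j hj).1⟩
  · intro h
    exact ⟨fun j hj => ⟨(h j hj).1, (h j hj).2.1⟩, fun j hj => ⟨(h j hj).2.2, by simp [(h j hj).1]⟩,
      by simp [hlast]⟩

lemma levelAt_eq (σ : Equiv.Perm (Fin (N + 1))) {x : ℕ} (h1 : 1 ≤ x) (hN : x ≤ N + 2) :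
    levelAt σ x = height 0 σ x := by
  rw [← height_eq_of_recursion (Or.inl rfl) σ (IsValley σ) (IsPeak σ) (fun v hv => ?_) h1 hN,
    height_one_of_eq]
  · rfl
  · rw [mem_Icc] at hv
    simp only [isValley_iff σ hv.1 hv.2, isPeak_iff σ hv.1 hv.2]
    cases (stepOf 0 σ v).1.1 <;> cases (stepOf 0 σ v).1.2 <;> simp

/-- The normalization condition of `F`-permutations. -/
def FNormal (h : ℕ) (s s' : Step) : Prop :=
  (s.1.1 = true ∨ s.1.2 = true) →
    (Even h → Even (h - 1 - s.2)) ∧ (Odd h → Even s'.2)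

instance (h : ℕ) (s s' : Step) : Decidable (FNormal h s s') := by
  unfold FNormal
  infer_instance

lemma isNormalizedFPerm_iff (n : ℕ) (σ : Equiv.Perm (Fin (2 * n + 1))) :
    IsNormalizedFPerm n σ ↔ IsFPerm n σ ∧ ∀ j ∈ range n,
      FNormal (height 0 σ (2 * j + 1)) (stepOf 0 σ (2 * j + 1)) (stepOf 0 σ (2 * j + 2)) := by
  refine and_congr_right fun hσ => ?_
  rw [forall_Icc_one]
  refine forall₂_congr fun j hj => ?_
  have hF := (isFPerm_iff n σ).1 hσ j hj
  rw [mem_range] at hj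
  obtain ⟨-, -, hbt⟩ := hF
  rw [IsVOP, vopEmbracing, show 2 * (j + 1) - 1 = 2 * j + 1 by omega,
    show 2 * (j + 1) = 2 * j + 2 by omega, levelAt_eq σ (by omega) (by omega),
    lesAt_eq_stepOf 0 σ (by omega) (by omega), resAt_eq_sub σ (by omega) (by omega),
    isValley_iff σ (by omega) (by omega), isPeak_iff σ (by omega) (by omega), FNormal]
  simp only [Int.even_coe_nat]
  refine imp_congr ?_ ?_
  · revert hbt
    cases (stepOf 0 σ (2 * j + 1)).1.1 <;> cases (stepOf 0 σ (2 * j + 1)).1.2 <;> simp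
  · rcases Nat.even_or_odd (height 0 σ (2 * j + 1)) with h | h
    · simp [h, Nat.not_odd_iff_even.2 h]
    · simp [h, Nat.not_even_iff_odd.2 h]

end EvenOddDrop

namespace EvenOddDrop

open Finset

/-! ### Weights of pairs of steps -/

variable {R : Type*} [CommSemiring R]

/-- The product of the weights of the consecutive pairs of steps of a history starting at
height `h`. -/
def pairWt (Ω : ℕ → Step → Step → R) : ℕ → List Step → R
  | h, s :: s' :: l => Ω h s s' * pairWt Ω (next (next h s.1) s'.1) l
  | _, _ => 1

/-- The generating function of the histories of length `2 * n + ρ` starting at height `h`. -/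
def pairSum (Ω : ℕ → Step → Step → R) (e ρ n h : ℕ) : R :=
  ∑ l ∈ histories e (2 * n + ρ) h, pairWt Ω h l

lemma pairSum_succ (Ω : ℕ → Step → Step → R) (e ρ n h : ℕ) :
    pairSum Ω e ρ (n + 1) h = ∑ s ∈ steps e h, ∑ s' ∈ steps e (next h s.1),
      Ω h s s' * pairSum Ω e ρ n (next (next h s.1) s'.1) := by
  rw [pairSum, show 2 * (n + 1) + ρ = 2 * n + ρ + 1 + 1 by ring, sum_histories_succ]
  refine sum_congr rfl fun s _ => ?_
  rw [sum_histories_succ]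
  refine sum_congr rfl fun s' _ => ?_
  rw [pairSum, mul_sum]
  rfl

lemma pairSum_zero_zero (Ω : ℕ → Step → Step → R) (h : ℕ) :
    pairSum Ω 0 0 0 h = if h = 0 then 1 else 0 := by
  rcases h with _ | h <;> simp [pairSum, histories, pairWt]

/-- The unpaired value 2n+1 must bring the height to 0. From positive height this is possible only
from 1, in a single way. -/
lemma pairSum_one_one (Ω : ℕ → Step → Step → R) (h : ℕ) :
    pairSum Ω 1 1 0 (h + 1) = if h = 0 then 1 else 0 := by
  rw [pairSum, sum_histories_succ]
  rcases h with _ | h <;> simp [sum_steps, histories, pairWt, next]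

/-- First-step decomposition of a Motzkin path. At `h = 0` the truncated `h - 1` is multiplied by an
empty sum. -/
lemma pairSum_succ_of_EPair {Ω : ℕ → Step → Step → R} (hΩ : ∀ h s s', ¬ EPair s s' → Ω h s s' = 0)
    (n h : ℕ) :
    pairSum Ω 0 0 (n + 1) h =
      (∑ i ∈ range (h + 1), ∑ j ∈ range (h + 2), Ω h ⟨(true, false), i⟩ ⟨(false, false), j⟩) *
        pairSum Ω 0 0 n (h + 1) +
      (∑ i ∈ range (h + 1), ∑ j ∈ range (h + 1), Ω h ⟨(false, false), i⟩ ⟨(false, false), j⟩) *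
        pairSum Ω 0 0 n h +
      (∑ i ∈ range (h + 1), ∑ j ∈ range h, Ω h ⟨(false, false), i⟩ ⟨(false, true), j⟩) *
        pairSum Ω 0 0 n (h - 1) := by
  have z1 : ∀ h i s', Ω h ⟨(true, true), i⟩ s' = 0 := fun h i s' => hΩ _ _ _ (by simp)
  have z2 : ∀ h i s', Ω h ⟨(false, true), i⟩ s' = 0 := fun h i s' => hΩ _ _ _ (by simp)
  have z3 : ∀ h s j, Ω h s ⟨(true, true), j⟩ = 0 := fun h i s' => hΩ _ _ _ (by simp)
  have z4 : ∀ h s j, Ω h s ⟨(true, false), j⟩ = 0 := fun h i s' => hΩ _ _ _ (by simp)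
  have z5 : ∀ h i j, Ω h ⟨(true, false), i⟩ ⟨(false, true), j⟩ = 0 :=
    fun h i s' => hΩ _ _ _ (by simp)
  rw [pairSum_succ]
  simp only [sum_steps, z1, z2, z3, z4, z5, zero_mul, sum_const_zero, zero_add, add_zero, next,
    Bool.toNat_true, Bool.toNat_false, Nat.sub_zero, ← sum_mul, sum_add_distrib]
  ring

lemma pairSum_succ_of_FPair {Ω : ℕ → Step → Step → R} (hΩ : ∀ h s s', ¬ FPair s s' → Ω h s s' = 0)
    (n h : ℕ) :
    pairSum Ω 1 1 (n + 1) h =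
      (∑ i ∈ range h, ∑ j ∈ range (h + 1), Ω h ⟨(true, false), i⟩ ⟨(false, false), j⟩) *
        pairSum Ω 1 1 n (h + 1) +
      (∑ i ∈ range h, ∑ j ∈ range h, Ω h ⟨(false, false), i⟩ ⟨(false, false), j⟩) *
        pairSum Ω 1 1 n h +
      (∑ i ∈ range h, ∑ j ∈ range (h - 1), Ω h ⟨(false, true), i⟩ ⟨(false, false), j⟩) *
        pairSum Ω 1 1 n (h - 1) := by
  have z1 : ∀ h i s', Ω h ⟨(true, true), i⟩ s' = 0 := fun h i s' => hΩ _ _ _ (by simp)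
  have z2 : ∀ h s j, Ω h s ⟨(false, true), j⟩ = 0 := fun h i s' => hΩ _ _ _ (by simp)
  have z3 : ∀ h s j, Ω h s ⟨(true, true), j⟩ = 0 := fun h i s' => hΩ _ _ _ (by simp)
  have z4 : ∀ h s j, Ω h s ⟨(true, false), j⟩ = 0 := fun h i s' => hΩ _ _ _ (by simp)
  rw [pairSum_succ]
  simp only [sum_steps, z1, z2, z3, z4, zero_mul, sum_const_zero, zero_add, add_zero, next,
    Bool.toNat_true, Bool.toNat_false, Nat.sub_zero, Nat.add_sub_cancel, ← sum_mul]
  ring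

/-- Sums over Motzkin paths depend on the weights of the up and down steps only through the
products of the weights of matching steps. -/
lemma motzkin_sum_eq {u u' b d d' : ℕ → R} {Z Z' : ℕ → ℕ → R}
    (hZ0 : ∀ h, Z 0 h = if h = 0 then 1 else 0) (hZ0' : ∀ h, Z' 0 h = if h = 0 then 1 else 0)
    (hZ : ∀ n h, Z (n + 1) h = u h * Z n (h + 1) + b h * Z n h + d h * Z n (h - 1))
    (hZ' : ∀ n h, Z' (n + 1) h = u' h * Z' n (h + 1) + b h * Z' n h + d' h * Z' n (h - 1))
    (hd : d 0 = 0) (hd' : d' 0 = 0) (hud : ∀ h, u h * d (h + 1) = u' h * d' (h + 1)) (n : ℕ) :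
    Z n 0 = Z' n 0 := by
  -- A path from height `h` to 0 has `h` unmatched down steps, one from each height `1, …, h`. Once
  -- their weights are factored out, only matched products remain, so both sums share the cofactor
  -- `y`; no division is needed.
  have key : ∀ n, ∃ y : ℕ → R, (∀ h, Z n h = (∏ i ∈ range h, d (i + 1)) * y h) ∧
      ∀ h, Z' n h = (∏ i ∈ range h, d' (i + 1)) * y h := by
    intro n
    induction n with
    | zero =>
      refine ⟨fun h => if h = 0 then 1 else 0, fun h => ?_, fun h => ?_⟩
      · rw [hZ0]
        rcases h with _ | h <;> simp
      · rw [hZ0']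
        rcases h with _ | h <;> simp
    | succ n ih =>
      obtain ⟨y, hy, hy'⟩ := ih
      refine ⟨fun h => u h * d (h + 1) * y (h + 1) + b h * y h +
        if h = 0 then 0 else y (h - 1), fun h => ?_, fun h => ?_⟩
      · rw [hZ, hy, hy, hy]
        rcases h with _ | h
        · simp [hd, mul_assoc]
        · simp only [prod_range_succ, Nat.add_sub_cancel, if_neg (Nat.succ_ne_zero h)]
          ring
      · simp only [hud]
        rw [hZ', hy', hy', hy']
        rcases h with _ | h
        · simp [hd', mul_assoc]
        · simp only [prod_range_succ, Nat.add_sub_cancel, if_neg (Nat.succ_ne_zero h)]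
          ring
  obtain ⟨y, hy, hy'⟩ := key n
  rw [hy, hy']
  simp

/-- The weight of a pair of steps whose values have right embracing numbers `r`, `r'`. -/
def pairTerm (a p q t : R) (r r' : ℕ) (s s' : Step) : R :=
  a ^ (if s'.1.1 = false ∧ s'.2 = 0 then 1 else 0) * p ^ (r + r') * q ^ (s.2 + s'.2) *
    t ^ (s.1.1.toNat + s'.1.1.toNat)

section Weights

variable (C : ℕ → Step → Step → Prop) [∀ h s s', Decidable (C h s s')] (a p q t : R)

/-- The weight of a pair of steps in an `E`-permutation. -/
def wtE (h : ℕ) (s s' : Step) : R :=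
  if EPair s s' ∧ C h s s' then
    pairTerm a p q t (h - s.1.2.toNat - s.2) (next h s.1 - s'.1.2.toNat - s'.2) s s' else 0

/-- The weight of a pair of steps in an `F`-permutation. -/
def wtF (h : ℕ) (s s' : Step) : R :=
  if FPair s s' ∧ C h s s' then
    pairTerm a p q t (h - 1 - s.2) (next h s.1 - 1 - s'.2) s s' else 0

end Weights

/-! ### The weight of a permutation -/

section History

variable {N : ℕ}

lemma pairWt_map_stepOf (Ω : ℕ → Step → Step → R) {z : ℕ} (hz : z = 0 ∨ z = N + 1)
    (σ : Equiv.Perm (Fin N)) {ρ : ℕ} (hρ : ρ ≤ 1) (n v : ℕ) (h1 : 1 ≤ v)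
    (hv : v + (2 * n + ρ) = N + 1) :
    pairWt Ω (height z σ v) ((List.range' v (2 * n + ρ)).map (stepOf z σ)) =
      ∏ j ∈ range n, Ω (height z σ (v + 2 * j)) (stepOf z σ (v + 2 * j))
        (stepOf z σ (v + 2 * j + 1)) := by
  induction n generalizing v with
  | zero => interval_cases ρ <;> simp [pairWt]
  | succ n ih =>
    rw [show 2 * (n + 1) + ρ = 2 * n + ρ + 1 + 1 by ring, List.range'_succ, List.range'_succ,
      List.map_cons, List.map_cons, pairWt, ← height_succ hz σ h1 (by omega),
      ← height_succ hz σ (by omega) (by omega), ih (v + 1 + 1) (by omega) (by omega),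
      prod_range_succ', mul_comm]
    refine congrArg₂ (· * ·) (prod_congr rfl fun j _ => ?_) rfl
    rw [show v + 1 + 1 + 2 * j = v + 2 * (j + 1) by ring]

lemma sum_Icc_two_mul {M : Type*} [AddCommMonoid M] (f : ℕ → M) (n : ℕ) :
    ∑ v ∈ Icc 1 (2 * n), f v = ∑ j ∈ range n, (f (2 * j + 1) + f (2 * j + 2)) := by
  induction n with
  | zero => simp
  | succ n ih =>
    rw [show 2 * (n + 1) = 2 * n + 1 + 1 by ring, sum_Icc_succ_top (by omega),
      sum_Icc_succ_top (by omega), ih, sum_range_succ, add_assoc]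

lemma prod_pairTerm (a p q t : R) (n : ℕ) (r r' : ℕ → ℕ) (s s' : ℕ → Step) :
    ∏ j ∈ range n, pairTerm a p q t (r j) (r' j) (s j) (s' j) =
      a ^ (∑ j ∈ range n, if (s' j).1.1 = false ∧ (s' j).2 = 0 then 1 else 0) *
        p ^ (∑ j ∈ range n, (r j + r' j)) * q ^ (∑ j ∈ range n, ((s j).2 + (s' j).2)) *
        t ^ (∑ j ∈ range n, ((s j).1.1.toNat + (s' j).1.1.toNat)) := by
  simp only [pairTerm, prod_mul_distrib, prod_pow_eq_pow_sum]

lemma not_even_two_mul_add_one (j : ℕ) : ¬ Even (2 * j + 1) :=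
  Nat.not_even_iff_odd.2 (odd_two_mul_add_one j)

lemma even_two_mul_add_two (j : ℕ) : Even (2 * j + 2) := ⟨j + 1, by ring⟩

variable (C : ℕ → Step → Step → Prop) [∀ h s s', Decidable (C h s s')] (a p q t : R)

lemma ite_eq_pairWt_wtE (n : ℕ) (σ : Equiv.Perm (Fin (2 * n))) (P : Prop) [Decidable P]
    (hP : P ↔ IsEPerm n σ ∧ ∀ j ∈ range n,
      C (height (2 * n + 1) σ (2 * j + 1)) (stepOf (2 * n + 1) σ (2 * j + 1))
        (stepOf (2 * n + 1) σ (2 * j + 2))) :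
    (if P then a ^ lema σ * p ^ ress σ * q ^ les σ * t ^ des σ else 0) =
      pairWt (wtE C a p q t) 0 (history (2 * n + 1) σ) := by
  have hz : 2 * n + 1 = 0 ∨ 2 * n + 1 = 2 * n + 1 := Or.inr rfl
  have key := pairWt_map_stepOf (wtE C a p q t) hz σ (Nat.zero_le 1) n 1 le_rfl (by omega)
  rw [height_one_of_ne] at key
  refine Eq.trans ?_ key.symm
  simp only [wtE, prod_ite_zero, prod_pairTerm]
  rw [isEPerm_iff, ← forall₂_and] at hP
  simp only [add_comm 1]
  refine if_congr hP ?_ rfl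
  rw [lema_eq_sum_stepOf hz, ress_eq_sum, les_eq_sum, des_eq_sum_stepOf (2 * n + 1),
    sum_Icc_two_mul, sum_Icc_two_mul, sum_Icc_two_mul, sum_Icc_two_mul]
  have e1 : ∀ j ∈ range n, lesAt σ (2 * j + 1) + lesAt σ (2 * j + 2) =
      (stepOf (2 * n + 1) σ (2 * j + 1)).2 + (stepOf (2 * n + 1) σ (2 * j + 2)).2 := by
    intro j hj
    rw [mem_range] at hj
    rw [lesAt_eq_stepOf (2 * n + 1) σ (by omega) (by omega),
      lesAt_eq_stepOf (2 * n + 1) σ (by omega) (by omega)]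
  rw [sum_congr rfl e1]
  have e2 := fun j (hj : j ∈ range n) => congrArg₂ (· + ·)
    (ressAt_eq_sub σ (v := 2 * j + 1) (by omega) (by rw [mem_range] at hj; omega))
    (ressAt_eq_sub σ (v := 2 * j + 2) (by omega) (by rw [mem_range] at hj; omega))
  rw [sum_congr rfl e2]
  simp only [not_even_two_mul_add_one, even_two_mul_add_two, false_and, if_false, zero_add,
    true_and]
  refine congrArg₂ (· * ·) (congrArg₂ (· * ·) (congrArg₂ (· * ·) rfl
    (congrArg (p ^ ·) (sum_congr rfl fun j hj => ?_))) rfl) rfl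
  rw [mem_range] at hj
  rw [← height_succ hz σ (by omega) (by omega)]

lemma ite_eq_pairWt_wtF (n : ℕ) (σ : Equiv.Perm (Fin (2 * n + 1))) (P : Prop) [Decidable P]
    (hP : P ↔ IsFPerm n σ ∧ ∀ j ∈ range n,
      C (height 0 σ (2 * j + 1)) (stepOf 0 σ (2 * j + 1)) (stepOf 0 σ (2 * j + 2))) :
    (if P then a ^ lema σ * p ^ res σ * q ^ les σ * t ^ des σ else 0) =
      pairWt (wtF C a p q t) 1 (history 0 σ) := by
  have hz : 0 = 0 ∨ 0 = 2 * n + 1 + 1 := Or.inl rfl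
  have key := pairWt_map_stepOf (wtF C a p q t) hz σ le_rfl n 1 le_rfl (by omega)
  rw [height_one_of_eq] at key
  refine Eq.trans ?_ key.symm
  simp only [wtF, prod_ite_zero, prod_pairTerm]
  rw [isFPerm_iff, ← forall₂_and] at hP
  simp only [add_comm 1]
  refine if_congr hP ?_ rfl
  have hbot : (stepOf 0 σ (2 * n + 1)).1.1 = false := by
    rw [← Bool.not_eq_true, stepOf_zero_bot_iff]
    have := entry_le σ (posOf σ (2 * n + 1) - 1)
    omega
  -- The height is 0 after the largest value and changes by at most one, so it is 1 before, which
  -- leaves nothing to embrace.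
  have hlast : lesAt σ (2 * n + 1) = 0 ∧ resAt σ (2 * n + 1) = 0 := by
    have h1 := height_succ_add hz σ (v := 2 * n + 1) (by omega) le_rfl
    rw [show height 0 σ (2 * n + 1 + 1) = 0 from (isWord_extWord hz σ).downCross_top, hbot] at h1
    have h2 := (isWord_extWord hz σ).strictCross_add_up (extWord_last 0 σ)
      (v := 2 * n + 1) (by omega) le_rfl
    rw [← resAt_eq σ (by omega) le_rfl, ← lesAt_eq 0 σ (by omega) le_rfl] at h2
    have h3 := Bool.toNat_le (stepOf 0 σ (2 * n + 1)).1.2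
    simp only [height, Bool.toNat_false] at h1
    omega
  rw [lema_eq_sum_stepOf hz, res_eq_sum, les_eq_sum, des_eq_sum_stepOf 0]
  simp only [sum_Icc_succ_top (show 1 ≤ 2 * n + 1 by omega), sum_Icc_two_mul, hlast.1, hlast.2,
    hbot, not_even_two_mul_add_one, even_two_mul_add_two, false_and, if_false, zero_add,
    true_and, Bool.toNat_false, add_zero]
  have e1 : ∀ j ∈ range n, lesAt σ (2 * j + 1) + lesAt σ (2 * j + 2) =
      (stepOf 0 σ (2 * j + 1)).2 + (stepOf 0 σ (2 * j + 2)).2 := by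
    intro j hj
    rw [mem_range] at hj
    rw [lesAt_eq_stepOf 0 σ (by omega) (by omega), lesAt_eq_stepOf 0 σ (by omega) (by omega)]
  rw [sum_congr rfl e1]
  have e2 := fun j (hj : j ∈ range n) => congrArg₂ (· + ·)
    (resAt_eq_sub σ (v := 2 * j + 1) (by omega) (by rw [mem_range] at hj; omega))
    (resAt_eq_sub σ (v := 2 * j + 2) (by omega) (by rw [mem_range] at hj; omega))
  rw [sum_congr rfl e2]
  refine congrArg₂ (· * ·) (congrArg₂ (· * ·) (congrArg₂ (· * ·) rfl
    (congrArg (p ^ ·) (sum_congr rfl fun j hj => ?_))) rfl) rfl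
  rw [mem_range] at hj
  rw [← height_succ hz σ (by omega) (by omega)]

end History

/-! ### The generating functions as sums over histories -/

lemma Xbar_eq (n : ℕ) (a p q t : R) :
    Xbar n a 1 p q t = pairSum (wtE (fun _ _ _ => True) a p q t) 0 0 n 0 := by
  rw [pairSum, add_zero, ← sum_history_zero, Xbar, sum_filter]
  refine sum_congr rfl fun σ _ => ?_
  rw [← ite_eq_pairWt_wtE _ a p q t n σ (IsEPerm n σ) (by simp)]
  simp

lemma Xhat_eq (n : ℕ) (p q t : R) :
    Xhat n 1 1 p q t = pairSum (wtE ENormal 1 p q t) 0 0 n 0 := by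
  rw [pairSum, add_zero, ← sum_history_zero, Xhat, sum_filter]
  refine sum_congr rfl fun σ _ => ?_
  rw [← ite_eq_pairWt_wtE _ 1 p q t n σ _ (isNormalizedEPerm_iff n σ)]
  simp

lemma Ybar_eq (n : ℕ) (a p q t : R) :
    Ybar n a p q t = pairSum (wtF (fun _ _ _ => True) a p q t) 1 1 n 1 := by
  rw [pairSum, ← sum_history_one, Ybar, sum_filter]
  refine sum_congr rfl fun σ _ => ?_
  rw [← ite_eq_pairWt_wtF _ a p q t n σ (IsFPerm n σ) (by simp)]

lemma Yhat_eq (n : ℕ) (p q t : R) :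
    Yhat n p q t = pairSum (wtF FNormal 1 p q t) 1 1 n 1 := by
  rw [pairSum, ← sum_history_one, Yhat, sum_filter]
  refine sum_congr rfl fun σ _ => ?_
  rw [← ite_eq_pairWt_wtF _ 1 p q t n σ _ (isNormalizedFPerm_iff n σ)]
  simp

/-! ### Comparison of the weights -/

/-- The sum of `p ^ (m - i) * q ^ i` over `i ≤ m` with `P i`. -/
def homogSum (p q : R) (m : ℕ) (P : ℕ → Prop) [DecidablePred P] : R :=
  ∑ i ∈ range (m + 1), if P i then p ^ (m - i) * q ^ i else 0

lemma homogSum_mul (p q c : R) (m m' : ℕ) (P P' : ℕ → Prop) [DecidablePred P]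
    [DecidablePred P'] :
    homogSum p q m P * homogSum p q m' P' * c =
      ∑ i ∈ range (m + 1), ∑ j ∈ range (m' + 1),
        if P i ∧ P' j then p ^ (m - i + (m' - j)) * q ^ (i + j) * c else 0 := by
  rw [homogSum, homogSum, sum_mul_sum, sum_mul]
  refine sum_congr rfl fun i _ => ?_
  rw [sum_mul]
  refine sum_congr rfl fun j _ => ?_
  by_cases hi : P i <;> by_cases hj : P' j <;> simp [hi, hj]
  ring

/-- The Motzkin principle with F-heights shifted by one. Level weights agree as soon as the side
conditions do, so only the products of matching up and down weights are left to compare. -/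
lemma pairSum_recursion (C C' : ℕ → Step → Step → Prop) [∀ h s s', Decidable (C h s s')]
    [∀ h s s', Decidable (C' h s s')] (a p q t : R)
    (hlevel : ∀ h i j, C h ⟨(false, false), i⟩ ⟨(false, false), j⟩ ↔
      C' (h + 1) ⟨(false, false), i⟩ ⟨(false, false), j⟩)
    (hud : ∀ h,
      (∑ i ∈ range (h + 1), ∑ j ∈ range (h + 2),
        wtE C a p q t h ⟨(true, false), i⟩ ⟨(false, false), j⟩) *
      (∑ i ∈ range (h + 2), ∑ j ∈ range (h + 1),
        wtE C a p q t (h + 1) ⟨(false, false), i⟩ ⟨(false, true), j⟩) =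
      (∑ i ∈ range (h + 1), ∑ j ∈ range (h + 2),
        wtF C' a p q t (h + 1) ⟨(true, false), i⟩ ⟨(false, false), j⟩) *
      (∑ i ∈ range (h + 2), ∑ j ∈ range (h + 1),
        wtF C' a p q t (h + 2) ⟨(false, true), i⟩ ⟨(false, false), j⟩)) (n : ℕ) :
    pairSum (wtF C' a p q t) 1 1 n 1 = pairSum (wtE C a p q t) 0 0 n 0 := by
  have hE := pairSum_succ_of_EPair (Ω := wtE C a p q t) fun h s s' hn =>
    if_neg fun hc => hn hc.1
  have hF := pairSum_succ_of_FPair (Ω := wtF C' a p q t) fun h s s' hn =>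
    if_neg fun hc => hn hc.1
  refine (motzkin_sum_eq (Z' := fun n h => pairSum (wtF C' a p q t) 1 1 n (h + 1))
    (u' := fun h => ∑ i ∈ range (h + 1), ∑ j ∈ range (h + 2),
      wtF C' a p q t (h + 1) ⟨(true, false), i⟩ ⟨(false, false), j⟩)
    (d' := fun h => ∑ i ∈ range (h + 1), ∑ j ∈ range h,
      wtF C' a p q t (h + 1) ⟨(false, true), i⟩ ⟨(false, false), j⟩)
    (pairSum_zero_zero _) (pairSum_one_one _) hE (fun n h => ?_) ?_ ?_ hud n).symm
  · rw [hF]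
    refine congrArg₂ (· + ·) (congrArg₂ (· + ·) rfl ?_) (?_ : _ =
      (∑ i ∈ range (h + 1), ∑ j ∈ range h,
        wtF C' a p q t (h + 1) ⟨(false, true), i⟩ ⟨(false, false), j⟩) * _)
    · refine congrArg (· * _) (sum_congr rfl fun i _ => sum_congr rfl fun j _ => ?_)
      simp [wtE, wtF, hlevel, next]
    · rcases h with _ | h
      · simp
      · rfl
  · simp
  · simp

lemma Ybar_eq_Xbar (n : ℕ) (a p q t : R) : Ybar n a p q t = Xbar n a 1 p q t := by
  rw [Ybar_eq, Xbar_eq]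
  refine pairSum_recursion _ _ a p q t (fun _ _ _ => Iff.rfl) (fun h => ?_) n
  refine congrArg₂ (· * ·) (sum_congr rfl fun i _ => sum_congr rfl fun j _ => ?_)
    (sum_congr rfl fun i _ => sum_congr rfl fun j _ => ?_)
  · simp [wtE, wtF, pairTerm, next]
  · simp [wtE, wtF, pairTerm, next]

lemma Yhat_eq_Xhat (n : ℕ) (p q t : R) : Yhat n p q t = Xhat n 1 1 p q t := by
  rw [Yhat_eq, Xhat_eq]
  refine pairSum_recursion _ _ 1 p q t (fun _ _ _ => by simp [ENormal, FNormal]) (fun h => ?_) n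
  rcases Nat.even_or_odd h with he | ho
  · have h1 : ¬ Odd h := Nat.not_odd_iff_even.2 he
    refine congrArg₂ (· * ·) (sum_congr rfl fun i _ => sum_congr rfl fun j _ => ?_)
      (sum_congr rfl fun i _ => sum_congr rfl fun j _ => ?_)
    · simp [wtE, wtF, pairTerm, next, ENormal, FNormal, he, h1, Nat.even_add_one]
    · simp [wtE, wtF, pairTerm, next, ENormal, FNormal, he, Nat.even_add_one, Nat.odd_add_one]
  · have h1 : ¬ Even h := Nat.not_even_iff_odd.2 ho
    have uE := homogSum_mul p q t h (h + 1) Even fun _ => True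
    have dE := homogSum_mul p q 1 (h + 1) h (fun _ => True) fun j => Even (h - j)
    have uF := homogSum_mul p q t h (h + 1) (fun j => Even (h - j)) fun _ => True
    have dF := homogSum_mul p q 1 (h + 1) h (fun _ => True) Even
    -- For odd `h` the condition `Even i` sits on the up step for E and on the down step for F, and
    -- `Even (h - i)` the other way round. The four homogeneous sums are the same, so commutativity
    -- finishes.
    trans (homogSum p q h Even * homogSum p q (h + 1) (fun _ => True) * t) *
      (homogSum p q (h + 1) (fun _ => True) * homogSum p q h (fun j => Even (h - j)) * 1)
    · rw [uE, dE]
      refine congrArg₂ (· * ·) (sum_congr rfl fun i _ => sum_congr rfl fun j _ => ?_)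
        (sum_congr rfl fun i _ => sum_congr rfl fun j _ => ?_)
      · simp [wtE, pairTerm, next, ENormal, ho, h1]
      · simp [wtE, pairTerm, next, ENormal, ho, Nat.odd_add_one]
    · trans (homogSum p q h (fun j => Even (h - j)) * homogSum p q (h + 1) (fun _ => True) * t) *
        (homogSum p q (h + 1) (fun _ => True) * homogSum p q h Even * 1)
      · ring
      · rw [uF, dF]
        refine congrArg₂ (· * ·) (sum_congr rfl fun i _ => sum_congr rfl fun j _ => ?_)
          (sum_congr rfl fun i _ => sum_congr rfl fun j _ => ?_)
        · simp [wtF, pairTerm, next, FNormal, ho, Nat.odd_add_one]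
        · simp [wtF, pairTerm, next, FNormal, ho, Nat.even_add_one, Nat.odd_add_one]

end EvenOddDrop

theorem mainTheorem11 {R : Type*} [CommSemiring R] (n : ℕ) (a p q t : R) :
    EvenOddDrop.Ybar n a p q t = EvenOddDrop.Xbar n a 1 p q t ∧
      EvenOddDrop.Yhat n p q t = EvenOddDrop.Xhat n 1 1 p q t :=
  ⟨EvenOddDrop.Ybar_eq_Xbar n a p q t, EvenOddDrop.Yhat_eq_Xhat n p q t⟩
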